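/- Let $p$ be a prime and let $G$ be a powerful finite $p$-group, that is, a finite $p$-group with $[G,G]\le G^p$ if $p$ is odd and $[G,G]\le G^4$ if $p=2$, where $G^n$ denotes the subgroup generated by all $n$-th powers of elements of $G$. Write $o(x)$ for the order of $x$ and $[x,y]=x^{-1}y^{-1}xy$; for an integer $i<0$, the inequality $o(x)\le p^i$ means, by convention, that $x=1$. For a finite $p$-group $H$ and $i\ge 0$, let $\Omega_i(H)$ be the subgroup generated by the elements of $H$ of order at most $p^i$, and let $\exp H$ be the exponent of $H$. A subgroup $T$ of $G$ is called cyclic over a normal subgroup $N$ of $G$ if $TN/N$ is cyclic ($T$ need not contain $N$). Then, for every integer $i\ge 0$: (i) If $x,y\in G$ and $o(y)\le p^i$, then $o([x,y])\le p^i$. (ii) If $x,y\in G$ are such that $o(x)\le p^{i+1}$ and $o(y)\le p^i$, then $o([x^{p^j},y^{p^k}])\le p^{i-j-k}$ for all integers $j,k\ge 0$. (iii) If $p$ is odd, then $\exp\Omega_i(G)\le p^i$. (iv) If $p=2$, then $\exp\Omega_i(T)\le 2^i$ for every subgroup $T$ of $G$ which is cyclic over $G^2$. In particular, $\exp\Omega_i(G^2)\le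 2^i$. -/

import Mathlib

/-- `G ^ n`: the subgroup of `G` generated by all the `n`-th powers of elements of `G`. -/
def powSubgroup (n : ℕ) (G : Type*) [Group G] : Subgroup G :=
  Subgroup.closure (Set.range fun g : G => g ^ n)

instance powSubgroup_normal (n : ℕ) (G : Type*) [Group G] : (powSubgroup n G).Normal := by
  have h : ∀ a ∈ Set.range (fun g : G => g ^ n), ∀ g : G,
      g * a * g⁻¹ ∈ Set.range (fun g : G => g ^ n) := by
    rintro _ ⟨b, rfl⟩ g
    exact ⟨g * b * g⁻¹, conj_pow⟩
  refine ⟨fun a ha g => ?_⟩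
  unfold powSubgroup at ha ⊢
  induction ha using Subgroup.closure_induction with
  | mem x hx => exact Subgroup.subset_closure (h x hx g)
  | one => simp
  | mul x y _ _ hx hy =>
    have e : g * (x * y) * g⁻¹ = (g * x * g⁻¹) * (g * y * g⁻¹) := by group
    rw [e]
    exact mul_mem hx hy
  | inv x _ hx =>
    have e : g * x⁻¹ * g⁻¹ = (g * x * g⁻¹)⁻¹ := by group
    rw [e]
    exact inv_mem hx

/-- A (finite) `p`-group `G` is powerful if `[G, G] ≤ G ^ p` when `p` is odd, and
`[G, G] ≤ G ^ 4` when `p = 2`. -/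
def IsPowerful (p : ℕ) (G : Type*) [Group G] : Prop :=
  commutator G ≤ powSubgroup (if p = 2 then 4 else p) G

/-- The inequality `o(x) ≤ p ^ i` for an integer `i`. For `i < 0` it means, by convention,
that `x = 1`. -/
def OrderLE (p : ℕ) {G : Type*} [Group G] (x : G) (i : ℤ) : Prop :=
  if 0 ≤ i then orderOf x ≤ p ^ i.toNat else x = 1

/-- `Ω_i(G)`, for `i ≥ 0`: the subgroup generated by the elements `x` with `o(x) ≤ p ^ i`. -/
def omegaSubgroup (p i : ℕ) (G : Type*) [Group G] : Subgroup G :=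
  Subgroup.closure {x : G | orderOf x ≤ p ^ i}

/-- A subgroup `T` of `G` is cyclic over a normal subgroup `N` (not necessarily contained in `T`)
if its image `T N / N` in `G / N` is cyclic. -/
def IsCyclicOver {G : Type*} [Group G] (T N : Subgroup G) [N.Normal] : Prop :=
  IsCyclic (T.map (QuotientGroup.mk' N))

/-- The commutator `[x, y] = x⁻¹ y⁻¹ x y`. -/
def groupComm {G : Type*} [Group G] (x y : G) : G := x⁻¹ * y⁻¹ * x * y

universe u

open scoped commutatorElement

/-! All bounds are proved together, for every subgroup K with `PowerfullyEmbedded p K K`, by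
induction on |K| (`PowerfullyEmbedded.hasOmegaBounds`). Put H = K^p; it is powerful, and proper
unless K = 1, so the bounds hold in H.

Commutators: for y in K the subgroup T = ⟨y⟩H is powerful. If T = K, then K is cyclic. Otherwise ⁅x,
y⁆ is the product of a conjugate of y and y⁻¹, both in T, and for p = 2 it lies in K^4 ≤ T^2; so the
product bound in T applies.

Commutators of powers: with c = ⁅y, x⁆ one has ⁅y, x^p⁆ = (cx)^p x^(-p), which is collected modulo
the elements of K^(p^2) of order dividing p^r, a subgroup by the product bound in H. The error terms
are commutators lying deep in the power filtration of K. Since K is powerful they are genuine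
p-power powers (`PowerfullyEmbedded.exists_pow_pow_eq`), so they are controlled by the bounds in H
or by descending induction on the exponent.

Products: induct on i and work modulo elements of order dividing p^i. For odd p, ⁅y, x⁆ is a p-th
power, hence commutes with x and y there, and (xy)^p is trivial. For p = 2 one of x, y, xy must lie
in K^2, which is what being cyclic over K^2 provides. If xy is the one in K^2, then x inverts it
modulo the torsion, and `sq_mem_of_inverted` finishes. -/

/-- The subgroup generated by the `n`-th powers of the elements of the subgroup `K`. -/
def powClosure {Γ : Type u} [Group Γ] (n : ℕ) (K : Subgroup Γ) : Subgroup Γ :=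
  Subgroup.closure {g | ∃ k ∈ K, k ^ n = g}

/-- Conjugation by the elements of `K` maps `N` into itself. -/
def NormalizedBy {Γ : Type u} [Group Γ] (N K : Subgroup Γ) : Prop :=
  ∀ g ∈ K, ∀ n ∈ N, g * n * g⁻¹ ∈ N

/-! ### Calculus modulo a normalized subgroup, and nilpotency and Frattini arguments. -/

section Basic

variable {Γ : Type u} [Group Γ] {N M K : Subgroup Γ}

/-- `N` need not lie in `K`: the quotient is `K` by `N ∩ K`. It turns congruences modulo `N` between
elements of `K` into equations in a group. -/
theorem exists_hom_of_normalizedBy (h : NormalizedBy N K) :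
    ∃ (Q : Type u) (_ : Group Q) (φ : K →* Q), ∀ g : K, φ g = 1 ↔ (g : Γ) ∈ N := by
  have : (N.subgroupOf K).Normal := ⟨fun n hn g => by
    simpa [Subgroup.mem_subgroupOf] using h g g.2 n (Subgroup.mem_subgroupOf.1 hn)⟩
  refine ⟨K ⧸ N.subgroupOf K, inferInstance, QuotientGroup.mk' _, fun g => ?_⟩
  rw [← MonoidHom.mem_ker, QuotientGroup.ker_mk', Subgroup.mem_subgroupOf]

theorem mul_pow_of_commute_commutator {Q : Type*} [Group Q] {c x : Q}
    (hx : Commute ⁅x, c⁆ x) (hc : Commute ⁅x, c⁆ c) (n : ℕ) :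
    (c * x) ^ n = ⁅x, c⁆ ^ n.choose 2 * c ^ n * x ^ n := by
  have key : ∀ n : ℕ, x ^ n * c = ⁅x, c⁆ ^ n * c * x ^ n := by
    intro n
    induction n with
    | zero => simp
    | succ n ih =>
      have e : x * c = ⁅x, c⁆ * c * x := by rw [commutatorElement_def]; group
      have e2 := (hx.pow_left n).eq
      calc x ^ (n + 1) * c = x * (x ^ n * c) := by rw [pow_succ' x, mul_assoc]
        _ = (x * ⁅x, c⁆ ^ n) * c * x ^ n := by rw [ih]; group
        _ = ⁅x, c⁆ ^ n * (x * c) * x ^ n := by rw [← e2]; group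
        _ = ⁅x, c⁆ ^ (n + 1) * c * x ^ (n + 1) := by
          rw [e, pow_succ, pow_succ' x]; simp only [mul_assoc]
  induction n with
  | zero => simp
  | succ n ih =>
    have e2 := ((hc.pow_left n).pow_right n).eq
    rw [pow_succ, ih]
    calc ⁅x, c⁆ ^ n.choose 2 * c ^ n * x ^ n * (c * x)
        = ⁅x, c⁆ ^ n.choose 2 * c ^ n * (x ^ n * c) * x := by group
      _ = ⁅x, c⁆ ^ n.choose 2 * (c ^ n * ⁅x, c⁆ ^ n) * c * x ^ n * x := by rw [key]; group
      _ = ⁅x, c⁆ ^ n.choose 2 * (⁅x, c⁆ ^ n * c ^ n) * c * x ^ n * x := by rw [e2]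
      _ = _ := by
        have : (n + 1).choose 2 = n.choose 2 + n := by
          rw [Nat.choose_succ_succ' n 1, Nat.choose_one_right, add_comm]
        rw [this, pow_add, pow_succ c, pow_succ x]; simp only [mul_assoc]

/-- The `p`-power map is multiplicative modulo `N` on a pair of elements whose commutator is
central of order `p` (trivial for `p = 2`) modulo `N`. -/
theorem mul_pow_mul_inv_mem {p : ℕ} (hp : p.Prime) (h : NormalizedBy N K) {c x : Γ}
    (hc : c ∈ K) (hx : x ∈ K) (hz : ⁅x, c⁆ ^ p ∈ N) (hzx : ⁅⁅x, c⁆, x⁆ ∈ N)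
    (hzc : ⁅⁅x, c⁆, c⁆ ∈ N) (h2 : p = 2 → ⁅x, c⁆ ∈ N) :
    (c * x) ^ p * (x ^ p)⁻¹ * (c ^ p)⁻¹ ∈ N := by
  obtain ⟨Q, _, φ, hφ⟩ := exists_hom_of_normalizedBy h
  set c' : K := ⟨c, hc⟩
  set x' : K := ⟨x, hx⟩
  have a1 : ⁅φ x', φ c'⁆ ^ p = 1 := by
    rw [← map_commutatorElement, ← map_pow]; exact (hφ _).2 hz
  have a2 : ⁅⁅φ x', φ c'⁆, φ x'⁆ = 1 := by
    simp only [← map_commutatorElement]; exact (hφ _).2 hzx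
  have a3 : ⁅⁅φ x', φ c'⁆, φ c'⁆ = 1 := by
    simp only [← map_commutatorElement]; exact (hφ _).2 hzc
  have a4 : p = 2 → ⁅φ x', φ c'⁆ = 1 := fun e => by
    rw [← map_commutatorElement]; exact (hφ _).2 (h2 e)
  refine (hφ ((c' * x') ^ p * (x' ^ p)⁻¹ * (c' ^ p)⁻¹)).1 ?_
  simp only [map_mul, map_pow, map_inv]
  rw [mul_pow_of_commute_commutator (commutatorElement_eq_one_iff_commute.1 a2)
    (commutatorElement_eq_one_iff_commute.1 a3)]
  -- For odd `p`, the prime `p` divides `p.choose 2`.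
  have : ⁅φ x', φ c'⁆ ^ p.choose 2 = 1 := by
    rcases hp.eq_two_or_odd with e | e
    · rw [a4 e, one_pow]
    · have : 2 < p := lt_of_le_of_ne hp.two_le (by rintro rfl; simp at e)
      obtain ⟨d, hd⟩ := hp.dvd_choose_self two_ne_zero this
      rw [hd, pow_mul, a1, one_pow]
  rw [this]; group

theorem commutatorElement_pow_right (y x : Γ) (n : ℕ) :
    ⁅y, x ^ n⁆ = (⁅y, x⁆ * x) ^ n * (x ^ n)⁻¹ := by
  have : ⁅y, x⁆ * x = y * x * y⁻¹ := by rw [commutatorElement_def]; group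
  rw [this, conj_pow, commutatorElement_def]

/-- Collect ⁅y, x^p⁆ = (cx)^p x^(-p), where c = ⁅y, x⁆: modulo `N` only c^p survives. -/
theorem commutatorElement_pow_mem {p : ℕ} (hp : p.Prime) (h : NormalizedBy N K) {y x : Γ}
    (hc : ⁅y, x⁆ ∈ K) (hx : x ∈ K) (hcp : ⁅y, x⁆ ^ p ∈ N) (hz : ⁅x, ⁅y, x⁆⁆ ^ p ∈ N)
    (hzx : ⁅⁅x, ⁅y, x⁆⁆, x⁆ ∈ N)
    (hzc : ⁅⁅x, ⁅y, x⁆⁆, ⁅y, x⁆⁆ ∈ N) (h2 : p = 2 → ⁅x, ⁅y, x⁆⁆ ∈ N) :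
    ⁅y, x ^ p⁆ ∈ N := by
  rw [commutatorElement_pow_right]
  simpa using mul_mem (mul_pow_mul_inv_mem hp h hc hx hz hzx hzc h2) hcp

theorem mul_pow_mem {p : ℕ} (hp : p.Prime) (h : NormalizedBy N K) {c x : Γ}
    (hc : c ∈ K) (hx : x ∈ K) (hcp : c ^ p ∈ N) (hxp : x ^ p ∈ N)
    (hz : ⁅x, c⁆ ^ p ∈ N) (hzx : ⁅⁅x, c⁆, x⁆ ∈ N)
    (hzc : ⁅⁅x, c⁆, c⁆ ∈ N) (h2 : p = 2 → ⁅x, c⁆ ∈ N) :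
    (c * x) ^ p ∈ N := by
  have := mul_mem (mul_mem (mul_pow_mul_inv_mem hp h hc hx hz hzx hzc h2) hcp) hxp
  simpa using this

theorem NormalizedBy.self : NormalizedBy K K := fun _ hg _ hn =>
  mul_mem (mul_mem hg hn) (inv_mem hg)

theorem NormalizedBy.commutator_mem_left (h : NormalizedBy N K) {n g : Γ} (hn : n ∈ N)
    (hg : g ∈ K) : ⁅n, g⁆ ∈ N := by
  have : ⁅n, g⁆ = n * (g * n⁻¹ * g⁻¹) := by rw [commutatorElement_def]; group
  rw [this]
  exact mul_mem hn (h g hg _ (inv_mem hn))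

theorem NormalizedBy.of_commutator_mem (h : ∀ g ∈ K, ∀ n ∈ N, ⁅g, n⁆ ∈ N) :
    NormalizedBy N K := by
  intro g hg n hn
  have : g * n * g⁻¹ = ⁅g, n⁆ * n := by rw [commutatorElement_def]; group
  rw [this]
  exact mul_mem (h g hg n hn) hn

theorem normalizedBy_closure {S : Set Γ} (h : ∀ g ∈ K, ∀ s ∈ S, g * s * g⁻¹ ∈ S) :
    NormalizedBy (Subgroup.closure S) K := by
  intro g hg n hn
  induction hn using Subgroup.closure_induction with
  | mem s hs => exact Subgroup.subset_closure (h g hg s hs)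
  | one => simp
  | mul a b _ _ ha hb => rw [conj_mul.symm]; exact mul_mem ha hb
  | inv a _ ha => rw [← conj_inv]; exact inv_mem ha

theorem NormalizedBy.sup {N' : Subgroup Γ} (h : NormalizedBy N K) (h' : NormalizedBy N' K) :
    NormalizedBy (N ⊔ N') K := by
  rw [← Subgroup.closure_eq N, ← Subgroup.closure_eq N', ← Subgroup.closure_union]
  refine normalizedBy_closure ?_
  rintro g hg s (hs | hs)
  · exact Or.inl (h g hg s hs)
  · exact Or.inr (h' g hg s hs)

theorem NormalizedBy.commutator (h : NormalizedBy N K) (h' : NormalizedBy M K) :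
    NormalizedBy ⁅N, M⁆ K := by
  rw [Subgroup.commutator_def]
  refine normalizedBy_closure ?_
  rintro g hg _ ⟨a, ha, b, hb, rfl⟩
  exact ⟨_, h g hg a ha, _, h' g hg b hb, by simp only [commutatorElement_def]; group⟩

theorem NormalizedBy.powClosure {n : ℕ} (h : NormalizedBy N K) :
    NormalizedBy (powClosure n N) K := by
  refine normalizedBy_closure ?_
  rintro g hg _ ⟨a, ha, rfl⟩
  exact ⟨_, h g hg a ha, conj_pow⟩

theorem commutator_le_of_generators {S : Set Γ} (hN : NormalizedBy N K) (hS : S ⊆ K)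
    (h : ∀ s ∈ S, ∀ g ∈ M, ⁅g, s⁆ ∈ N) : ⁅Subgroup.closure S, M⁆ ≤ N := by
  rw [Subgroup.commutator_le]
  intro a ha g hg
  rw [← commutatorElement_inv]
  refine inv_mem ?_
  induction ha using Subgroup.closure_induction with
  | mem s hs => exact h s hs g hg
  | one => simp
  | mul a b ha hb iha ihb =>
    have : ⁅g, a * b⁆ = ⁅g, a⁆ * (a * ⁅g, b⁆ * a⁻¹) := by
      simp only [commutatorElement_def]; group
    rw [this]
    exact mul_mem iha (hN a ((Subgroup.closure_le K).2 hS ha) _ ihb)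
  | inv a ha iha =>
    have : ⁅g, a⁻¹⁆ = a⁻¹ * ⁅g, a⁆⁻¹ * a⁻¹⁻¹ := by
      simp only [commutatorElement_def]; group
    rw [this]
    exact hN _ (inv_mem ((Subgroup.closure_le K).2 hS ha)) _ (inv_mem iha)

theorem pow_mem_powClosure {n : ℕ} {k : Γ} (hk : k ∈ K) : k ^ n ∈ powClosure n K :=
  Subgroup.subset_closure ⟨k, hk, rfl⟩

theorem powClosure_le {n : ℕ} : powClosure n K ≤ K := by
  refine (Subgroup.closure_le _).2 ?_
  rintro _ ⟨k, hk, rfl⟩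
  exact pow_mem hk n

theorem powClosure_mono {n : ℕ} (h : M ≤ K) : powClosure n M ≤ powClosure n K := by
  refine Subgroup.closure_mono ?_
  rintro _ ⟨k, hk, rfl⟩
  exact ⟨k, h hk, rfl⟩

theorem powClosure_mul_le {m n : ℕ} : powClosure (m * n) K ≤ powClosure n (powClosure m K) := by
  refine (Subgroup.closure_le _).2 ?_
  rintro _ ⟨k, hk, rfl⟩
  rw [pow_mul]
  exact pow_mem_powClosure (pow_mem_powClosure hk)

theorem powClosure_mul_le_left {m n : ℕ} : powClosure (m * n) K ≤ powClosure m K := by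
  refine (Subgroup.closure_le _).2 ?_
  rintro _ ⟨k, hk, rfl⟩
  rw [pow_mul]
  exact pow_mem (pow_mem_powClosure hk) n

theorem commutator_le_of_normalizedBy (h : NormalizedBy N K) : ⁅N, K⁆ ≤ N := by
  rw [Subgroup.commutator_le]
  exact fun a ha b hb => h.commutator_mem_left ha hb

/-- A nilpotency argument: to show `M ≤ R` it is enough to work modulo `⁅M, K⁆`. -/
theorem le_of_le_sup_commutator [Group.IsNilpotent Γ] {R : Subgroup Γ} (hR : NormalizedBy R K)
    (h : M ≤ R ⊔ ⁅M, K⁆) : M ≤ R := by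
  have key : ∀ n, M ≤ R ⊔ (⊤ : Subgroup Γ).lowerCentralSeries n := by
    intro n
    induction n with
    | zero => simp
    | succ n ih =>
      refine h.trans (sup_le le_sup_left ?_)
      rw [Subgroup.commutator_le]
      intro a ha k hk
      obtain ⟨r, hr, x, hx, rfl⟩ := Subgroup.mem_sup_of_normal_right.1 (ih ha)
      have e : ⁅r * x, k⁆ = ⁅r, ⁅x, k⁆⁆ * ⁅x, k⁆ * ⁅r, k⁆ := by
        simp only [commutatorElement_def]; group
      have hxk : ⁅x, k⁆ ∈ (⊤ : Subgroup Γ).lowerCentralSeries (n + 1) :=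
        Subgroup.commutator_mem_commutator hx (Subgroup.mem_top k)
      rw [e]
      refine mul_mem (mul_mem ?_ (Subgroup.mem_sup_right hxk))
        (Subgroup.mem_sup_left (hR.commutator_mem_left hr hk))
      exact Subgroup.mem_sup_right (Subgroup.commutator_le_right _ _
        (Subgroup.commutator_mem_commutator (Subgroup.mem_top r) hxk))
  obtain ⟨n, hn⟩ := Subgroup.nilpotent_iff_lowerCentralSeries.1 ‹Group.IsNilpotent Γ›
  have := key n
  rwa [hn, sup_bot_eq] at this

/-- Frattini argument: a proper `A` lies in a normal subgroup of index `p`, which also contains all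
`p`-th powers. -/
theorem eq_of_sup_powClosure [Finite Γ] {p : ℕ} (hp : p.Prime) (hΓ : IsPGroup p Γ)
    {A : Subgroup Γ} (hA : A ≤ K) (h : K ≤ A ⊔ powClosure p K) : A = K := by
  have : Fact p.Prime := ⟨hp⟩
  by_contra hne
  have hKp := hΓ.to_subgroup K
  obtain ⟨m, hm⟩ := IsPGroup.iff_card.1 hKp
  obtain ⟨n, hn⟩ := IsPGroup.iff_card.1 (hΓ.to_subgroup A)
  have hlt : n < m := by
    have : Nat.card A < Nat.card K := by
      refine lt_of_le_of_ne (Subgroup.card_le_of_le hA) fun e => hne ?_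
      exact Subgroup.eq_of_le_of_card_ge hA e.ge
    rw [hm, hn] at this
    exact (Nat.pow_lt_pow_iff_right hp.one_lt).1 this
  obtain ⟨m, rfl⟩ : ∃ k, m = k + 1 := ⟨m - 1, by omega⟩
  have hAc : Nat.card (A.subgroupOf K) = p ^ n := by
    rw [← hn]; exact Nat.card_congr (Subgroup.subgroupOfEquivOfLe hA).toEquiv
  obtain ⟨B, hB, hAB⟩ := Sylow.exists_subgroup_card_pow_prime_le p
    (n := n) (m := m) (by rw [hm]; exact pow_dvd_pow p (Nat.le_succ m)) (A.subgroupOf K) hAc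
    (by omega)
  have hidx : B.index = p := by
    have := B.card_mul_index
    rw [hB, hm, pow_succ] at this
    exact Nat.eq_of_mul_eq_mul_left (pow_pos hp.pos m) this
  have hBn : B.Normal := by
    refine Subgroup.normal_of_index_eq_minFac_card ?_
    rw [hidx, hm, Nat.Prime.pow_minFac hp (Nat.succ_ne_zero m)]
  have hle : K ≤ B.map K.subtype := by
    refine h.trans (sup_le ?_ ((Subgroup.closure_le _).2 ?_))
    · intro a ha
      exact ⟨⟨a, hA ha⟩, hAB (Subgroup.mem_subgroupOf.2 ha), rfl⟩
    · rintro _ ⟨k, hk, rfl⟩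
      refine ⟨⟨k, hk⟩ ^ p, ?_, rfl⟩
      rw [← hidx]
      exact Subgroup.pow_index_mem B _
  have : Nat.card K ≤ Nat.card B := by
    refine (Subgroup.card_le_of_le hle).trans ?_
    exact (Nat.card_congr (B.equivMapOfInjective _ K.subtype_injective).toEquiv).ge
  rw [hB, hm] at this
  exact absurd ((Nat.pow_le_pow_iff_right hp.one_lt).1 this) (by omega)

end Basic

/-! ### Powerful embedding, the power filtration, and extraction of roots. -/

/-- A subgroup `N` of `K` is powerfully embedded in `K` if it is normalized by `K` and
`⁅N, K⁆ ≤ N ^ p` for odd `p`, or `⁅N, K⁆ ≤ N ^ 4` for `p = 2`. -/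
structure PowerfullyEmbedded {Γ : Type u} [Group Γ] (p : ℕ) (N K : Subgroup Γ) : Prop where
  le : N ≤ K
  normalizedBy : NormalizedBy N K
  commutator_le : ⁅N, K⁆ ≤ powClosure (if p = 2 then 4 else p) N

/-- The iterated power subgroup `K ^ p ^ ⋯ ^ p`. -/
def iterPow {Γ : Type u} [Group Γ] (p : ℕ) (K : Subgroup Γ) (n : ℕ) : Subgroup Γ :=
  (powClosure p)^[n] K

section Powerful

variable {Γ : Type u} [Group Γ] {p : ℕ} {N M K : Subgroup Γ}

theorem iterPow_succ (n : ℕ) : iterPow p K (n + 1) = powClosure p (iterPow p K n) :=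
  Function.iterate_succ_apply' _ _ _

theorem iterPow_succ_le (n : ℕ) : iterPow p K (n + 1) ≤ iterPow p K n := by
  rw [iterPow_succ]; exact powClosure_le

theorem iterPow_antitone : Antitone (iterPow p K) := antitone_nat_of_succ_le iterPow_succ_le

theorem iterPow_le (n : ℕ) : iterPow p K n ≤ K := iterPow_antitone (Nat.zero_le n)

theorem pow_mem_iterPow_add {w : Γ} {n : ℕ} (hw : w ∈ iterPow p K n) (m : ℕ) :
    w ^ p ^ m ∈ iterPow p K (n + m) := by
  induction m with
  | zero => simpa using hw
  | succ m ih =>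
    rw [pow_succ, pow_mul, ← add_assoc, iterPow_succ]
    exact pow_mem_powClosure ih

theorem pow_mem_iterPow {w : Γ} (hw : w ∈ K) (n : ℕ) : w ^ p ^ n ∈ iterPow p K n := by
  simpa using pow_mem_iterPow_add (p := p) (n := 0) hw n

theorem NormalizedBy.iterPow (h : NormalizedBy N K) (n : ℕ) : NormalizedBy (iterPow p N n) K := by
  induction n with
  | zero => exact h
  | succ n ih => rw [iterPow_succ]; exact ih.powClosure

theorem powClosure_ite_le : powClosure (if p = 2 then 4 else p) K ≤ powClosure p K := by
  split_ifs with h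
  · subst h; exact powClosure_mul_le_left (m := 2) (n := 2)
  · exact le_rfl

theorem commutator_pow_two_mem {y x : Γ} (h : NormalizedBy N K) (hc : ⁅y, x⁆ ∈ K) (hx : x ∈ K)
    (hc2 : ⁅y, x⁆ ^ 2 ∈ N) (hz : ⁅x, ⁅y, x⁆⁆ ∈ N) : ⁅y, x ^ 2⁆ ∈ N :=
  commutatorElement_pow_mem Nat.prime_two h hc hx hc2 (pow_mem hz 2)
    (h.commutator_mem_left hz hx) (h.commutator_mem_left hz hc) fun _ => hz

/-- With z = ⁅a, b⁆ commuting with a and b, bilinearity gives ⁅a², b²⁆ = z⁴. -/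
theorem commute_sq_sq {Q : Type*} [Group Q] {a b : Q} (h1 : Commute ⁅a, b⁆ a)
    (h2 : Commute ⁅a, b⁆ b) (h4 : ⁅a, b⁆ ^ 4 = 1) : ⁅a ^ 2, b ^ 2⁆ = 1 := by
  have e : a * b = ⁅a, b⁆ * b * a := by rw [commutatorElement_def]; group
  generalize ⁅a, b⁆ = z at *
  have h1 := h1.eq
  have h2 := h2.eq
  have e1 : a * b ^ 2 = z ^ 2 * b ^ 2 * a := by
    calc a * b ^ 2 = (a * b) * b := by rw [pow_two, mul_assoc]
      _ = z * b * (a * b) := by rw [e, mul_assoc (z * b), e]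
      _ = z * (b * z) * b * a := by rw [e]; simp only [mul_assoc]
      _ = _ := by rw [← h2]; simp only [pow_two, mul_assoc]
  have h1' : z ^ 2 * a = a * z ^ 2 := (Commute.pow_left h1 2).eq
  rw [commutatorElement_eq_one_iff_mul_comm]
  calc a ^ 2 * b ^ 2 = a * (a * b ^ 2) := by rw [pow_two a, mul_assoc]
    _ = (a * z ^ 2) * b ^ 2 * a := by rw [e1]; group
    _ = z ^ 2 * (a * b ^ 2) * a := by rw [← h1']; group
    _ = z ^ 4 * b ^ 2 * a ^ 2 := by
      rw [e1, show 4 = 2 + 2 from rfl, pow_add, pow_two a]; simp only [mul_assoc]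
    _ = b ^ 2 * a ^ 2 := by rw [h4, one_mul]

theorem commutator_sq_sq_mem {a b : Γ} (h : NormalizedBy N K) (ha : a ∈ K) (hb : b ∈ K)
    (h1 : ⁅⁅a, b⁆, a⁆ ∈ N) (h2 : ⁅⁅a, b⁆, b⁆ ∈ N) (h4 : ⁅a, b⁆ ^ 4 ∈ N) :
    ⁅a ^ 2, b ^ 2⁆ ∈ N := by
  obtain ⟨Q, _, φ, hφ⟩ := exists_hom_of_normalizedBy h
  set a' : K := ⟨a, ha⟩
  set b' : K := ⟨b, hb⟩
  refine (hφ ⁅a' ^ 2, b' ^ 2⁆).1 ?_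
  rw [map_commutatorElement, map_pow, map_pow]
  refine commute_sq_sq ?_ ?_ ?_
  · rw [← commutatorElement_eq_one_iff_commute]
    simp only [← map_commutatorElement]; exact (hφ _).2 h1
  · rw [← commutatorElement_eq_one_iff_commute]
    simp only [← map_commutatorElement]; exact (hφ _).2 h2
  · rw [← map_commutatorElement, ← map_pow]; exact (hφ _).2 h4

theorem PowerfullyEmbedded.commutator_le' (h : PowerfullyEmbedded p N K) :
    ⁅N, K⁆ ≤ powClosure p N := h.commutator_le.trans powClosure_ite_le

theorem mem_of_mem_commutator_le {a b : Γ} {R : Subgroup Γ} (h : ⁅N, M⁆ ≤ R) (ha : a ∈ N)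
    (hb : b ∈ M) : ⁅a, b⁆ ∈ R := h (Subgroup.commutator_mem_commutator ha hb)

theorem mem_of_mem_commutator_le' {a b : Γ} {R : Subgroup Γ} (h : ⁅N, M⁆ ≤ R) (ha : a ∈ N)
    (hb : b ∈ M) : ⁅b, a⁆ ∈ R := by
  rw [← commutatorElement_inv]; exact inv_mem (mem_of_mem_commutator_le h ha hb)

theorem PowerfullyEmbedded.powClosure_of_odd [Group.IsNilpotent Γ] (hp : p.Prime) (h2 : p ≠ 2)
    (h : PowerfullyEmbedded p N K) :
    ⁅powClosure p N, K⁆ ≤ powClosure p (powClosure p N) := by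
  have hH : NormalizedBy (powClosure p N) K := h.normalizedBy.powClosure
  have hR : NormalizedBy (powClosure p (powClosure p N)) K := hH.powClosure
  have hM : NormalizedBy ⁅powClosure p N, K⁆ K := hH.commutator .self
  have hML := hM.commutator .self
  refine le_of_le_sup_commutator hR ?_
  have hNK := h.le
  refine commutator_le_of_generators (K := K) (hR.sup hML) ?_ ?_
  · rintro _ ⟨n, hn, rfl⟩; exact pow_mem (hNK hn) p
  rintro _ ⟨n, hn, rfl⟩ g hg
  have hc : ⁅g, n⁆ ∈ powClosure p N := mem_of_mem_commutator_le' h.commutator_le' hn hg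
  have hcK : ⁅g, n⁆ ∈ K := hNK (powClosure_le hc)
  have hz : ⁅n, ⁅g, n⁆⁆ ∈ ⁅powClosure p N, K⁆ := mem_of_mem_commutator_le' le_rfl hc (hNK hn)
  have hz' : ⁅n, ⁅g, n⁆⁆ ∈ powClosure p N := commutator_le_of_normalizedBy hH hz
  exact commutatorElement_pow_mem hp (hR.sup hML) hcK (hNK hn)
    (Subgroup.mem_sup_left (pow_mem_powClosure hc))
    (Subgroup.mem_sup_left (pow_mem_powClosure hz'))
    (Subgroup.mem_sup_right (Subgroup.commutator_mem_commutator hz (hNK hn)))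
    (Subgroup.mem_sup_right (Subgroup.commutator_mem_commutator hz hcK)) fun e => absurd e h2

/-- Modulo L, the subgroup E = (N²)² is abelian of exponent dividing 2. As ⁅N, K⁆ ≤ N⁴ ≤ E, both
⁅N⁴, N⁆ and then ⁅N², K⁆ collapse into L. -/
theorem PowerfullyEmbedded.powClosure_two [Group.IsNilpotent Γ]
    (h : PowerfullyEmbedded 2 N K) :
    ⁅powClosure 2 N, K⁆ ≤ powClosure 4 (powClosure 2 N) := by
  have hcomm : ⁅N, K⁆ ≤ powClosure 4 N := by simpa using h.commutator_le
  have hNK := h.le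
  have hH : NormalizedBy (powClosure 2 N) K := h.normalizedBy.powClosure
  have hR : NormalizedBy (powClosure 4 (powClosure 2 N)) K := hH.powClosure
  have hM : NormalizedBy ⁅powClosure 2 N, K⁆ K := hH.commutator .self
  have hMH : ⁅powClosure 2 N, K⁆ ≤ powClosure 2 N := commutator_le_of_normalizedBy hH
  have hHN : powClosure 2 N ≤ N := powClosure_le
  have hHK : powClosure 2 N ≤ K := hHN.trans hNK
  have h4E : powClosure 4 N ≤ powClosure 2 (powClosure 2 N) :=
    powClosure_mul_le (m := 2) (n := 2)
  refine le_of_le_sup_commutator hR ?_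
  have hL := hR.sup (hM.commutator .self)
  set L := powClosure 4 (powClosure 2 N) ⊔ ⁅⁅powClosure 2 N, K⁆, K⁆ with hLdef
  have hML : ∀ {a b : Γ}, a ∈ ⁅powClosure 2 N, K⁆ → b ∈ K → ⁅a, b⁆ ∈ L := fun ha hb =>
    Subgroup.mem_sup_right (Subgroup.commutator_mem_commutator ha hb)
  have hML' : ∀ {a b : Γ}, a ∈ ⁅powClosure 2 N, K⁆ → b ∈ K → ⁅b, a⁆ ∈ L := fun ha hb => by
    rw [← commutatorElement_inv]; exact inv_mem (hML ha hb)
  have hE : ⁅powClosure 2 (powClosure 2 N), powClosure 2 (powClosure 2 N)⁆ ≤ L := by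
    refine commutator_le_of_generators (K := K) hL ?_ ?_
    · rintro _ ⟨n, hn, rfl⟩; exact pow_mem (hHK hn) 2
    rintro _ ⟨a, ha, rfl⟩ g hg
    -- The reduction to generators acts on one argument only; a cyclic second argument keeps the
    -- other entry a square.
    have : ⁅powClosure 2 (powClosure 2 N), Subgroup.zpowers (a ^ 2)⁆ ≤ L := by
      refine commutator_le_of_generators (K := K) hL ?_ ?_
      · rintro _ ⟨n, hn, rfl⟩; exact pow_mem (hHK hn) 2
      rintro _ ⟨b, hb, rfl⟩ g hg
      obtain ⟨k, rfl⟩ := Subgroup.mem_zpowers_iff.1 hg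
      have hab : ⁅a ^ k, b⁆ ∈ ⁅powClosure 2 N, K⁆ :=
        Subgroup.commutator_mem_commutator (zpow_mem ha k) (hHK hb)
      rw [← zpow_natCast, ← zpow_mul, mul_comm, zpow_mul, zpow_natCast]
      refine commutator_sq_sq_mem hL (zpow_mem (hHK ha) k) (hHK hb)
        (hML hab (zpow_mem (hHK ha) k)) (hML hab (hHK hb)) ?_
      exact Subgroup.mem_sup_left (pow_mem_powClosure (hMH hab))
    exact mem_of_mem_commutator_le this hg (Subgroup.mem_zpowers _)
  have hEK : powClosure 2 (powClosure 2 N) ≤ K := powClosure_le.trans hHK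
  have hsq : ∀ e ∈ powClosure 2 (powClosure 2 N), e ^ 2 ∈ L := by
    intro e he
    have hexp : e ∈ powClosure 2 (powClosure 2 N) ∧ e ^ 2 ∈ L := by
      induction he using Subgroup.closure_induction with
      | mem s hs =>
        obtain ⟨a, ha, rfl⟩ := hs
        refine ⟨pow_mem_powClosure ha, ?_⟩
        rw [← pow_mul]
        exact Subgroup.mem_sup_left (pow_mem_powClosure ha)
      | one => exact ⟨one_mem _, by simp⟩
      | inv a _ ha => exact ⟨inv_mem ha.1, by rw [inv_pow]; exact inv_mem ha.2⟩
      | mul a b _ _ ha hb =>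
        have hba := mem_of_mem_commutator_le hE hb.1 ha.1
        exact ⟨mul_mem ha.1 hb.1, mul_pow_mem Nat.prime_two hL (hEK ha.1) (hEK hb.1) ha.2 hb.2
          (pow_mem hba 2) (hL.commutator_mem_left hba (hEK hb.1))
          (hL.commutator_mem_left hba (hEK ha.1)) fun _ => hba⟩
    exact hexp.2
  have hN4 : ⁅powClosure 4 N, N⁆ ≤ L := by
    refine commutator_le_of_generators (K := K) hL ?_ ?_
    · rintro _ ⟨n, hn, rfl⟩; exact pow_mem (hNK hn) 4
    rintro _ ⟨m, hm, rfl⟩ n hn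
    rw [show m ^ 4 = (m ^ 2) ^ 2 by rw [← pow_mul]]
    have hm2 : m ^ 2 ∈ powClosure 2 N := pow_mem_powClosure hm
    have hc : ⁅n, m ^ 2⁆ ∈ ⁅powClosure 2 N, K⁆ := mem_of_mem_commutator_le' le_rfl hm2 (hNK hn)
    refine commutator_pow_two_mem hL (hHK (hMH hc)) (hHK hm2) ?_ (hML' hc (hHK hm2))
    exact hsq _ (h4E (hcomm (Subgroup.commutator_mono hHN le_rfl hc)))
  refine commutator_le_of_generators (K := K) hL ?_ ?_
  · rintro _ ⟨n, hn, rfl⟩; exact pow_mem (hNK hn) 2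
  rintro _ ⟨n, hn, rfl⟩ g hg
  have hc : ⁅g, n⁆ ∈ powClosure 4 N := mem_of_mem_commutator_le' hcomm hn hg
  exact commutator_pow_two_mem hL (hEK (h4E hc)) (hNK hn) (hsq _ (h4E hc))
    (mem_of_mem_commutator_le' hN4 hc hn)

theorem PowerfullyEmbedded.powClosure [Group.IsNilpotent Γ] (hp : p.Prime)
    (h : PowerfullyEmbedded p N K) : PowerfullyEmbedded p (powClosure p N) K where
  le := powClosure_le.trans h.le
  normalizedBy := h.normalizedBy.powClosure
  commutator_le := by
    split_ifs with h2
    · subst h2; exact h.powClosure_two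
    · exact h.powClosure_of_odd hp h2

theorem PowerfullyEmbedded.iterPow [Group.IsNilpotent Γ] (hp : p.Prime)
    (h : PowerfullyEmbedded p N K) (n : ℕ) : PowerfullyEmbedded p (iterPow p N n) K := by
  induction n with
  | zero => exact h
  | succ n ih => rw [iterPow_succ]; exact ih.powClosure hp

theorem PowerfullyEmbedded.of_le {T : Subgroup Γ} (h : PowerfullyEmbedded p N K)
    (hNT : N ≤ T) (hT : ⁅T, T⁆ ≤ ⁅N, K⁆) : PowerfullyEmbedded p T T where
  le := le_rfl
  normalizedBy := .self
  commutator_le := hT.trans (h.commutator_le.trans (powClosure_mono hNT))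

theorem PowerfullyEmbedded.self (h : PowerfullyEmbedded p N K) : PowerfullyEmbedded p N N :=
  h.of_le le_rfl (Subgroup.commutator_mono le_rfl h.le)

/-- Modulo ⁅N, K⁆ the subgroup ⟨x⟩N is generated by the commuting pieces ⟨x⟩ and N, with N central.
-/
theorem commutator_zpowers_sup_le {x : Γ} (hN : NormalizedBy N K) (hNK : N ≤ K) (hx : x ∈ K) :
    ⁅Subgroup.zpowers x ⊔ N, Subgroup.zpowers x ⊔ N⁆ ≤ ⁅N, K⁆ := by
  have hT : Subgroup.zpowers x ⊔ N ≤ K := sup_le (by simpa using hx) hNK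
  have hR : NormalizedBy ⁅N, K⁆ K := hN.commutator .self
  have h1 : ∀ g ∈ Subgroup.zpowers x ⊔ N, ⁅g, x⁆ ∈ ⁅N, K⁆ := by
    intro g hg
    have := commutator_le_of_generators (S := {x} ∪ N) (N := ⁅N, K⁆) (M := Subgroup.zpowers x)
      (K := K) hR ?_ ?_
    · refine mem_of_mem_commutator_le this ?_ (Subgroup.mem_zpowers x)
      rwa [Subgroup.closure_union, Subgroup.closure_eq, ← Subgroup.zpowers_eq_closure]
    · rintro s (rfl | hs)
      · exact hx
      · exact hNK hs
    · rintro s (rfl | hs) g hg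
      · obtain ⟨k, rfl⟩ := Subgroup.mem_zpowers_iff.1 hg
        rw [commutatorElement_eq_one_iff_commute.2 ((Commute.refl _).zpow_left k)]
        exact one_mem _
      · exact mem_of_mem_commutator_le' le_rfl hs (hT (Subgroup.mem_sup_left hg))
  have := commutator_le_of_generators (S := {x} ∪ N) (N := ⁅N, K⁆)
      (M := Subgroup.zpowers x ⊔ N) (K := K) hR ?_ ?_
  · rwa [Subgroup.closure_union, Subgroup.closure_eq, ← Subgroup.zpowers_eq_closure] at this
  · rintro s (rfl | hs)
    · exact hx
    · exact hNK hs
  · rintro s (rfl | hs) g hg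
    · exact h1 g hg
    · exact mem_of_mem_commutator_le' le_rfl hs (hT hg)

theorem PowerfullyEmbedded.zpowers_sup [Group.IsNilpotent Γ] (hp : p.Prime)
    (h : PowerfullyEmbedded p K K) {x : Γ} (hx : x ∈ K) :
    PowerfullyEmbedded p (Subgroup.zpowers x ⊔ _root_.powClosure p K)
      (Subgroup.zpowers x ⊔ _root_.powClosure p K) :=
  have hH := h.powClosure hp
  hH.of_le le_sup_right
    (commutator_zpowers_sup_le hH.normalizedBy hH.le hx)

/-- Modulo (K^p)^p the commutator ⁅x, c⁆ ∈ K^p is central of order dividing p; for p = 2 it is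
trivial, since K⁴ ≤ (K²)². -/
theorem PowerfullyEmbedded.powMap_mod [Group.IsNilpotent Γ] (hp : p.Prime)
    (h : PowerfullyEmbedded p K K) {c x : Γ} (hc : c ∈ K) (hx : x ∈ K) :
    (c * x) ^ p * (x ^ p)⁻¹ * (c ^ p)⁻¹ ∈ _root_.powClosure p (_root_.powClosure p K) := by
  have hH := h.powClosure hp
  have hz : ⁅x, c⁆ ∈ _root_.powClosure p K := mem_of_mem_commutator_le h.commutator_le' hx hc
  refine mul_pow_mul_inv_mem hp hH.normalizedBy.powClosure hc hx (pow_mem_powClosure hz)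
    (mem_of_mem_commutator_le hH.commutator_le' hz hx)
    (mem_of_mem_commutator_le hH.commutator_le' hz hc) ?_
  rintro rfl
  have := mem_of_mem_commutator_le h.commutator_le hx hc
  exact powClosure_mul_le (m := 2) (n := 2) this

theorem PowerfullyEmbedded.exists_pow_mul_eq [Group.IsNilpotent Γ] (hp : p.Prime)
    (h : PowerfullyEmbedded p K K) {g : Γ} (hg : g ∈ _root_.powClosure p K) :
    ∃ x ∈ K, ∃ r ∈ _root_.powClosure p (_root_.powClosure p K), r * x ^ p = g := by
  have hR : NormalizedBy (_root_.powClosure p (_root_.powClosure p K)) K :=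
    (h.powClosure hp).normalizedBy.powClosure
  induction hg using Subgroup.closure_induction with
  | mem s hs =>
    obtain ⟨k, hk, rfl⟩ := hs
    exact ⟨k, hk, 1, one_mem _, by simp⟩
  | one => exact ⟨1, one_mem _, 1, one_mem _, by simp⟩
  | inv a _ ha =>
    obtain ⟨x, hx, r, hr, rfl⟩ := ha
    refine ⟨x⁻¹, inv_mem hx, _, hR _ (inv_mem (pow_mem hx p)) _ (inv_mem hr), ?_⟩
    rw [inv_pow]; group
  | mul a b _ _ ha hb =>
    obtain ⟨x, hx, r, hr, rfl⟩ := ha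
    obtain ⟨y, hy, s, hs, rfl⟩ := hb
    refine ⟨x * y, mul_mem hx hy, r * (x ^ p * s * (x ^ p)⁻¹) *
      (((x * y) ^ p * (y ^ p)⁻¹ * (x ^ p)⁻¹))⁻¹, mul_mem (mul_mem hr (hR _ (pow_mem hx p) _ hs))
        (inv_mem (h.powMap_mod hp hx hy)), by group⟩

/-- In a powerful `p`-group, the elements of the `p`-power subgroup are `p`-th powers. -/
theorem PowerfullyEmbedded.exists_pow_eq [Finite Γ] (hp : p.Prime) (hΓ : IsPGroup p Γ)
    (h : PowerfullyEmbedded p K K) {g : Γ} (hg : g ∈ _root_.powClosure p K) :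
    ∃ x ∈ K, x ^ p = g := by
  have : Fact p.Prime := ⟨hp⟩
  have : Group.IsNilpotent Γ := hΓ.isNilpotent
  induction hn : Nat.card K using Nat.strong_induction_on generalizing K g with
  | _ n ih =>
    obtain ⟨x, hx, r, hr, rfl⟩ := h.exists_pow_mul_eq hp hg
    have hTK : Subgroup.zpowers x ⊔ _root_.powClosure p K ≤ K :=
      sup_le (by simpa using hx) powClosure_le
    -- The element r x^p is in T^p for the powerful T = ⟨x⟩K^p. Either T is smaller, or K = ⟨x⟩ is
    -- cyclic.
    rcases eq_or_ne (Subgroup.zpowers x ⊔ _root_.powClosure p K) K with e | e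
    · have hK : Subgroup.zpowers x = K :=
        eq_of_sup_powClosure hp hΓ (by simpa using hx) e.ge
      have : ∀ g ∈ _root_.powClosure p K, ∃ k ∈ K, k ^ p = g := by
        intro g hg
        induction hg using Subgroup.closure_induction with
        | mem s hs => exact hs
        | one => exact ⟨1, one_mem _, one_pow _⟩
        | inv a _ ha =>
          obtain ⟨k, hk, rfl⟩ := ha
          exact ⟨k⁻¹, inv_mem hk, inv_pow _ _⟩
        | mul a b _ _ ha hb =>
          obtain ⟨k, hk, rfl⟩ := ha
          obtain ⟨l, hl, rfl⟩ := hb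
          refine ⟨k * l, mul_mem hk hl, Commute.mul_pow ?_ p⟩
          rw [← hK] at hk hl
          obtain ⟨i, rfl⟩ := Subgroup.mem_zpowers_iff.1 hk
          obtain ⟨j, rfl⟩ := Subgroup.mem_zpowers_iff.1 hl
          exact (Commute.refl x).zpow_zpow i j
      exact this _ hg
    · have hlt : Nat.card ↥(Subgroup.zpowers x ⊔ _root_.powClosure p K) < n := by
        rw [← hn]
        refine lt_of_le_of_ne (Subgroup.card_le_of_le hTK) fun e' => e ?_
        exact Subgroup.eq_of_le_of_card_ge hTK e'.ge
      obtain ⟨k, hk, hk'⟩ := ih _ hlt (h.zpowers_sup hp hx)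
        (mul_mem (powClosure_mono le_sup_right hr)
          (pow_mem_powClosure (Subgroup.mem_sup_left (Subgroup.mem_zpowers x)))) rfl
      exact ⟨k, hTK hk, hk'⟩

theorem PowerfullyEmbedded.exists_pow_pow_eq [Finite Γ] (hp : p.Prime) (hΓ : IsPGroup p Γ)
    (h : PowerfullyEmbedded p K K) {n : ℕ} {g : Γ} (hg : g ∈ _root_.iterPow p K n) :
    ∃ x ∈ K, x ^ p ^ n = g := by
  have : Fact p.Prime := ⟨hp⟩
  have : Group.IsNilpotent Γ := hΓ.isNilpotent
  induction n generalizing g with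
  | zero => exact ⟨g, hg, by simp⟩
  | succ n ih =>
    rw [iterPow_succ] at hg
    obtain ⟨y, hy, rfl⟩ := (h.iterPow hp n).self.exists_pow_eq hp hΓ hg
    obtain ⟨x, hx, rfl⟩ := ih hy
    exact ⟨x, hx, by rw [pow_succ, pow_mul]⟩

theorem PowerfullyEmbedded.commutator_iterPow_le [Group.IsNilpotent Γ] (hp : p.Prime)
    (h : PowerfullyEmbedded p K K) (n : ℕ) :
    ⁅_root_.iterPow p K n, K⁆ ≤ _root_.iterPow p K (n + 1) := by
  rw [iterPow_succ]; exact (h.iterPow hp n).commutator_le'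

theorem PowerfullyEmbedded.commutator_iterPow_two_le [Group.IsNilpotent Γ]
    (h : PowerfullyEmbedded 2 K K) (n : ℕ) :
    ⁅_root_.iterPow 2 K n, K⁆ ≤ _root_.iterPow 2 K (n + 2) := by
  rw [iterPow_succ, iterPow_succ]
  refine (h.iterPow Nat.prime_two n).commutator_le.trans ?_
  exact powClosure_mul_le (m := 2) (n := 2)

end Powerful

/-! ### Orders of commutators and, for odd p, of products. -/

/-- The bounds for orders of commutators and products of elements of the subgroup `K`. -/
structure HasOmegaBounds {Γ : Type u} [Group Γ] (p : ℕ) (K : Subgroup Γ) : Prop where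
  commutator : ∀ ⦃i : ℕ⦄ ⦃x y : Γ⦄, x ∈ K → y ∈ K → y ^ p ^ i = 1 → ⁅x, y⁆ ^ p ^ i = 1
  commutator_pow : ∀ ⦃r : ℕ⦄ (j k : ℕ) ⦃x y : Γ⦄, x ∈ K → y ∈ K → x ^ p ^ (r + j + k + 1) = 1 →
    y ^ p ^ (r + j + k) = 1 → ⁅x ^ p ^ j, y ^ p ^ k⁆ ^ p ^ r = 1
  mul : ∀ ⦃i : ℕ⦄ ⦃x y : Γ⦄, x ∈ K → y ∈ K → x ^ p ^ i = 1 → y ^ p ^ i = 1 →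
    (p = 2 → x ∈ powClosure p K ∨ y ∈ powClosure p K ∨ x * y ∈ powClosure p K) →
    (x * y) ^ p ^ i = 1

/-- The elements of `M` of exponent dividing `n`, when they are closed under multiplication. -/
def torsionIn {Γ : Type u} [Group Γ] (M : Subgroup Γ) (n : ℕ)
    (h : ∀ x ∈ M, ∀ y ∈ M, x ^ n = 1 → y ^ n = 1 → (x * y) ^ n = 1) : Subgroup Γ where
  carrier := {x | x ∈ M ∧ x ^ n = 1}
  one_mem' := ⟨one_mem _, one_pow _⟩
  mul_mem' := fun hx hy => ⟨mul_mem hx.1 hy.1, h _ hx.1 _ hy.1 hx.2 hy.2⟩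
  inv_mem' := fun hx => ⟨inv_mem hx.1, by rw [inv_pow, hx.2, inv_one]⟩

section Bounds

variable {Γ : Type u} [Group Γ] {p : ℕ} {M K : Subgroup Γ}

theorem NormalizedBy.torsionIn {n : ℕ}
    {h : ∀ x ∈ M, ∀ y ∈ M, x ^ n = 1 → y ^ n = 1 → (x * y) ^ n = 1} (hM : NormalizedBy M K) :
    NormalizedBy (torsionIn M n h) K := by
  intro g hg x hx
  exact ⟨hM g hg x hx.1, by rw [conj_pow, hx.2, mul_one, mul_inv_cancel]⟩

theorem pow_pow_pow_eq (x : Γ) (j r : ℕ) : (x ^ p ^ j) ^ p ^ r = x ^ p ^ (j + r) := by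
  rw [← pow_mul, ← pow_add]

theorem pow_pow_pow_one_eq (x : Γ) (r : ℕ) : (x ^ p) ^ p ^ r = x ^ p ^ (r + 1) := by
  rw [← pow_mul, ← pow_succ']

theorem pow_pow_eq_one_of_le {x : Γ} {m n : ℕ} (h : m ≤ n) (hx : x ^ p ^ m = 1) :
    x ^ p ^ n = 1 := by
  obtain ⟨d, rfl⟩ := Nat.exists_eq_add_of_le h
  rw [← pow_pow_pow_eq, hx, one_pow]

theorem commutator_swap_pow_eq_one {x y : Γ} {n : ℕ} (h : ⁅x, y⁆ ^ n = 1) : ⁅y, x⁆ ^ n = 1 := by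
  rw [← commutatorElement_inv, inv_pow, h, inv_one]

/-- `iterPow p K 2` is the p-power subgroup of K^p, so the side condition at p = 2 is automatic and
its torsion is a subgroup. -/
theorem HasOmegaBounds.mul_powClosure (hH : HasOmegaBounds p (powClosure p K)) {r : ℕ} :
    ∀ x ∈ iterPow p K 2, ∀ y ∈ iterPow p K 2, x ^ p ^ r = 1 → y ^ p ^ r = 1 →
      (x * y) ^ p ^ r = 1 := fun _ hx _ hy h1 h2 =>
  hH.mul (powClosure_le hx) (powClosure_le hy) h1 h2 fun _ => Or.inl hx

/-- As u is already in K^p, all commutators of u with ⁅y, u⁆ are covered by the bounds in K^p. -/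
theorem PowerfullyEmbedded.commutator_pow_step [Finite Γ] (hp : p.Prime) (hΓ : IsPGroup p Γ)
    (h : PowerfullyEmbedded p K K) (hH : HasOmegaBounds p (_root_.powClosure p K)) {r : ℕ}
    {u y : Γ} (hu : u ∈ _root_.powClosure p K) (hy : y ∈ K) (hur : u ^ p ^ (r + 2) = 1)
    (hyu : ⁅y, u⁆ ^ p ^ (r + 1) = 1) : ⁅y, u ^ p⁆ ^ p ^ r = 1 := by
  have : Fact p.Prime := ⟨hp⟩
  have : Group.IsNilpotent Γ := hΓ.isNilpotent
  have hHK : _root_.powClosure p K ≤ K := powClosure_le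
  have hpe := (h.powClosure hp).self
  have hN := (NormalizedBy.self.iterPow (K := K) (p := p) 2).torsionIn
    (h := hH.mul_powClosure (r := r))
  have hc : ⁅y, u⁆ ∈ _root_.iterPow p K 2 :=
    mem_of_mem_commutator_le' (h.commutator_iterPow_le hp 1) hu hy
  have hcH : ⁅y, u⁆ ∈ _root_.powClosure p K := powClosure_le hc
  have hz : ⁅u, ⁅y, u⁆⁆ ∈ _root_.iterPow p (_root_.powClosure p K) 2 :=
    mem_of_mem_commutator_le' (hpe.commutator_iterPow_le hp 1) hc hu
  have hz1 : ⁅u, ⁅y, u⁆⁆ ∈ _root_.iterPow p (_root_.powClosure p K) 1 := iterPow_succ_le 1 hz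
  have hzr : ⁅u, ⁅y, u⁆⁆ ^ p ^ (r + 1) = 1 := hH.commutator hu hcH hyu
  refine (commutatorElement_pow_mem hp hN (hHK hcH) (hHK hu) ⟨pow_mem hc p, ?_⟩
    ⟨pow_mem hz1 p, ?_⟩ ⟨?_, ?_⟩ ⟨?_, ?_⟩ ?_).2
  · rw [pow_pow_pow_one_eq, hyu]
  · rw [pow_pow_pow_one_eq, hzr]
  · exact mem_of_mem_commutator_le (hpe.commutator_le') (powClosure_le hz1) hu
  · obtain ⟨v, hv, hvz⟩ := hpe.exists_pow_pow_eq hp hΓ hz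
    rw [← hvz, pow_pow_pow_eq] at hzr
    simpa [hvz] using hH.commutator_pow (r := r) 2 0 hv hu
      (pow_pow_eq_one_of_le (by omega) hzr) hur
  · exact mem_of_mem_commutator_le (hpe.commutator_le') (powClosure_le hz1) hcH
  -- Here z = v^(p²), so v has order dividing p^(r+3), just what the bound with j = 2 requires.
  · obtain ⟨v, hv, hvz⟩ := hpe.exists_pow_pow_eq hp hΓ hz1
    rw [← hvz, pow_pow_pow_eq] at hzr
    have := hH.commutator_pow (r := r) 1 0 hv hcH (pow_pow_eq_one_of_le (by omega) hzr) hyu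
    rwa [hvz, pow_zero, pow_one] at this
  · rintro rfl
    refine ⟨hz1, ?_⟩
    have hc3 : ⁅y, u⁆ ∈ _root_.iterPow 2 (_root_.powClosure 2 K) 2 :=
      mem_of_mem_commutator_le' (h.commutator_iterPow_two_le 1) hu hy
    obtain ⟨v, hv, hvz⟩ := hpe.exists_pow_pow_eq hp hΓ hc3
    rw [← hvz, pow_pow_pow_eq] at hyu
    refine commutator_swap_pow_eq_one ?_
    have := hH.commutator_pow (r := r) 2 0 hv hu (pow_pow_eq_one_of_le (by omega) hyu) hur
    rwa [hvz, pow_zero, pow_one] at this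

theorem exists_forall_pow_eq_one [Finite Γ] (hΓ : IsPGroup p Γ) :
    ∃ e, ∀ g : Γ, ∀ n, e ≤ n → g ^ p ^ n = 1 := by
  have : Fintype Γ := Fintype.ofFinite Γ
  choose f hf using hΓ
  exact ⟨Finset.univ.sup f, fun g n hn =>
    pow_pow_eq_one_of_le ((Finset.le_sup (Finset.mem_univ g)).trans hn) (hf g)⟩

theorem PowerfullyEmbedded.commutator_pow_left [Finite Γ] (hp : p.Prime) (hΓ : IsPGroup p Γ)
    (h : PowerfullyEmbedded p K K) (hH : HasOmegaBounds p (_root_.powClosure p K))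
    (hK : ∀ ⦃i : ℕ⦄ ⦃x y : Γ⦄, x ∈ K → y ∈ K → y ^ p ^ i = 1 → ⁅x, y⁆ ^ p ^ i = 1)
    {k : ℕ} {x y : Γ} (hx : x ∈ K) (hy : y ∈ K) (hxk : x ^ p ^ (k + 2) = 1)
    (hyk : y ^ p ^ (k + 1) = 1) : ⁅x ^ p, y⁆ ^ p ^ k = 1 := by
  have : Fact p.Prime := ⟨hp⟩
  have : Group.IsNilpotent Γ := hΓ.isNilpotent
  obtain ⟨e, he⟩ := exists_forall_pow_eq_one hΓ
  -- Descending induction on k: for k ≥ e the exponent p^k kills the whole group.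
  suffices H : ∀ d k, e ≤ k + d → ∀ x ∈ K, ∀ y ∈ K, x ^ p ^ (k + 2) = 1 → y ^ p ^ (k + 1) = 1 →
      ⁅x ^ p, y⁆ ^ p ^ k = 1 from H e k (by omega) x hx y hy hxk hyk
  clear hxk hyk hx hy x y k
  intro d
  induction d with
  | zero => exact fun k hk x _ y _ _ _ => he _ k hk
  | succ d ih =>
    intro k hk x hx y hy hxk hyk
    have hHK : _root_.powClosure p K ≤ K := powClosure_le
    have hpe := (h.powClosure hp).self
    have hN := (NormalizedBy.self.iterPow (K := K) (p := p) 2).torsionIn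
      (h := hH.mul_powClosure (r := k))
    have hc : ⁅y, x⁆ ∈ _root_.powClosure p K := mem_of_mem_commutator_le h.commutator_le' hy hx
    have hck : ⁅y, x⁆ ^ p ^ (k + 1) = 1 := commutator_swap_pow_eq_one (hK hx hy hyk)
    have hz : ⁅x, ⁅y, x⁆⁆ ∈ _root_.iterPow p K 2 :=
      mem_of_mem_commutator_le' (h.commutator_iterPow_le hp 1) hc hx
    have hzk : ⁅x, ⁅y, x⁆⁆ ^ p ^ (k + 1) = 1 := hK hx (hHK hc) hck
    -- The case k + 1 bounds ⁅v^p, x⁆, and `commutator_pow_step` with u = v^p passes to v^(p²).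
    have key : ∀ v ∈ K, (v ^ p ^ 2) ^ p ^ (k + 1) = 1 → ⁅x, v ^ p ^ 2⁆ ^ p ^ k = 1 := by
      intro v hv hvk
      rw [pow_pow_pow_eq] at hvk
      have h1 := ih (k + 1) (by omega) v hv x hx (pow_pow_eq_one_of_le (by omega) hvk) hxk
      have h2 := h.commutator_pow_step hp hΓ hH (u := v ^ p) (pow_mem_powClosure hv) hx
        (r := k) (by rw [pow_pow_pow_one_eq]; exact pow_pow_eq_one_of_le (by omega) hvk)
        (commutator_swap_pow_eq_one h1)
      rwa [← pow_mul, ← pow_two] at h2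
    refine commutator_swap_pow_eq_one (commutatorElement_pow_mem hp hN (hHK hc) hx
      ⟨pow_mem_powClosure hc, ?_⟩ ⟨pow_mem hz p, ?_⟩ ⟨?_, ?_⟩ ⟨?_, ?_⟩ ?_).2
    · rw [pow_pow_pow_one_eq, hck]
    · rw [pow_pow_pow_one_eq, hzk]
    · exact iterPow_succ_le 2 (mem_of_mem_commutator_le (h.commutator_iterPow_le hp 2) hz hx)
    · obtain ⟨v, hv, hvz⟩ := h.exists_pow_pow_eq hp hΓ hz
      rw [← hvz] at hzk ⊢
      exact commutator_swap_pow_eq_one (key v hv hzk)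
    · exact iterPow_succ_le 2
        (mem_of_mem_commutator_le (h.commutator_iterPow_le hp 2) hz (hHK hc))
    · obtain ⟨v, hv, hvz⟩ := hpe.exists_pow_eq hp hΓ (g := ⁅x, ⁅y, x⁆⁆) hz
      rw [← hvz, pow_pow_pow_one_eq] at hzk
      simpa [hvz] using hH.commutator_pow (r := k) 1 0 hv hc hzk hck
    -- For p = 2, ⁅y, x⁆ ∈ K⁴ is itself a fourth power, so `key` bounds ⁅x, ⁅y, x⁆⁆ directly.
    · rintro rfl
      refine ⟨hz, ?_⟩
      obtain ⟨v, hv, hvz⟩ := h.exists_pow_pow_eq hp hΓ (n := 2) (g := ⁅y, x⁆)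
        (mem_of_mem_commutator_le (h.commutator_iterPow_two_le 0) hy hx)
      rw [← hvz] at hck ⊢
      exact key v hv hck

theorem PowerfullyEmbedded.commutator_pow_pow [Finite Γ] (hp : p.Prime) (hΓ : IsPGroup p Γ)
    (h : PowerfullyEmbedded p K K) (hH : HasOmegaBounds p (_root_.powClosure p K))
    (hK : ∀ ⦃i : ℕ⦄ ⦃x y : Γ⦄, x ∈ K → y ∈ K → y ^ p ^ i = 1 → ⁅x, y⁆ ^ p ^ i = 1)
    {r : ℕ} (j k : ℕ) {x y : Γ} (hx : x ∈ K) (hy : y ∈ K) (hxr : x ^ p ^ (r + j + k + 1) = 1)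
    (hyr : y ^ p ^ (r + j + k) = 1) : ⁅x ^ p ^ j, y ^ p ^ k⁆ ^ p ^ r = 1 := by
  have : Fact p.Prime := ⟨hp⟩
  have : Group.IsNilpotent Γ := hΓ.isNilpotent
  have left : ∀ j r x y, x ∈ K → y ∈ K → x ^ p ^ (r + j + 1) = 1 → y ^ p ^ (r + j) = 1 →
      ⁅x ^ p ^ j, y⁆ ^ p ^ r = 1 := by
    intro j
    induction j with
    | zero => intro r x y hx hy _ hyr; simpa using hK hx hy hyr
    | succ j ih =>
      intro r x y hx hy hxr hyr
      rcases j with _ | j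
      · simpa using h.commutator_pow_left hp hΓ hH hK hx hy hxr hyr
      · have h1 := ih (r + 1) x y hx hy (by rw [← hxr]; congr 2; omega)
          (by rw [← hyr]; congr 2; omega)
        rw [pow_succ, pow_mul]
        refine commutator_swap_pow_eq_one (h.commutator_pow_step hp hΓ hH
          (iterPow_antitone (Nat.le_add_left 1 j) (pow_mem_iterPow hx (j + 1))) hy ?_
          (commutator_swap_pow_eq_one h1))
        rw [pow_pow_pow_eq, ← hxr]; congr 2; omega
  induction k generalizing r with
  | zero => simpa using left j r x y hx hy hxr hyr
  | succ k ih =>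
    rcases j with _ | j
    · have := hK hx (pow_mem hy (p ^ (k + 1))) (i := r)
        (by rw [pow_pow_pow_eq, ← hyr]; congr 2; omega)
      simpa using this
    have h1 := ih (r := r + 1) (by rw [← hxr]; congr 2; omega) (by rw [← hyr]; congr 2; omega)
    rw [pow_succ p k, pow_mul y]
    have hN := (NormalizedBy.self.iterPow (K := K) (p := p) 2).torsionIn
      (h := hH.mul_powClosure (r := r))
    have hy' : y ^ p ^ k ∈ K := pow_mem hy _
    have hc : ⁅x ^ p ^ (j + 1), y ^ p ^ k⁆ ∈ _root_.iterPow p K (j + 2) :=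
      mem_of_mem_commutator_le (h.commutator_iterPow_le hp (j + 1)) (pow_mem_iterPow hx _) hy'
    have hc2 : ⁅x ^ p ^ (j + 1), y ^ p ^ k⁆ ∈ _root_.iterPow p K 2 :=
      iterPow_antitone (Nat.le_add_left 2 j) hc
    obtain ⟨v, hv, hvc⟩ := h.exists_pow_pow_eq hp hΓ hc
    have hcK := iterPow_le _ hc2
    have hz : ⁅y ^ p ^ k, ⁅x ^ p ^ (j + 1), y ^ p ^ k⁆⁆ ∈
        torsionIn (_root_.iterPow p K 2) (p ^ r) hH.mul_powClosure := by
      refine ⟨iterPow_succ_le 2 (mem_of_mem_commutator_le'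
        (h.commutator_iterPow_le hp 2) hc2 hy'), commutator_swap_pow_eq_one ?_⟩
      rw [← hvc, pow_pow_pow_eq] at h1
      rw [← hvc]
      -- The commutator is v^(p^(j+2)), one level deeper than x^(p^(j+1)), so `left` gains the
      -- missing factor p.
      refine left (j + 2) r v _ hv hy' (by rw [← h1]; congr 2; omega) ?_
      rw [pow_pow_pow_eq, ← hyr]; congr 2; omega
    refine (commutatorElement_pow_mem hp hN hcK hy' ⟨pow_mem hc2 p, ?_⟩ (pow_mem hz p)
      (hN.commutator_mem_left hz hy') (hN.commutator_mem_left hz hcK) fun _ => hz).2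
    rw [pow_pow_pow_one_eq, h1]

theorem PowerfullyEmbedded.mul_of_odd [Finite Γ] (hp : p.Prime) (hΓ : IsPGroup p Γ) (h2 : p ≠ 2)
    (h : PowerfullyEmbedded p K K) (hH : HasOmegaBounds p (_root_.powClosure p K))
    (hK : ∀ ⦃i : ℕ⦄ ⦃x y : Γ⦄, x ∈ K → y ∈ K → y ^ p ^ i = 1 → ⁅x, y⁆ ^ p ^ i = 1)
    {i : ℕ} {x y : Γ} (hx : x ∈ K) (hy : y ∈ K) (hxi : x ^ p ^ i = 1) (hyi : y ^ p ^ i = 1) :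
    (x * y) ^ p ^ i = 1 := by
  induction i generalizing x y with
  | zero => simp_all
  | succ i ih =>
    have hN := (NormalizedBy.self (K := K)).torsionIn (n := p ^ i)
      (h := fun x hx y hy hxi hyi => ih hx hy hxi hyi)
    have hz : ⁅y, x⁆ ∈ _root_.powClosure p K := mem_of_mem_commutator_le h.commutator_le' hy hx
    have hzK : ⁅y, x⁆ ∈ K := powClosure_le hz
    have hzi : ⁅y, x⁆ ^ p ^ (i + 1) = 1 := hK hy hx hxi
    obtain ⟨w, hw, hwz⟩ := h.exists_pow_eq hp hΓ hz
    have hwi : w ^ p ^ (i + 2) = 1 := by rw [← hzi, ← hwz, pow_pow_pow_one_eq]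
    rw [← pow_pow_pow_one_eq]
    refine (mul_pow_mem hp hN hx hy ⟨pow_mem hx p, ?_⟩ ⟨pow_mem hy p, ?_⟩ ⟨pow_mem hzK p, ?_⟩
      ⟨NormalizedBy.self.commutator_mem_left hzK hy, ?_⟩
      ⟨NormalizedBy.self.commutator_mem_left hzK hx, ?_⟩ fun e => absurd e h2).2
    · rw [pow_pow_pow_one_eq, hxi]
    · rw [pow_pow_pow_one_eq, hyi]
    · rw [pow_pow_pow_one_eq, hzi]
    · rw [← hwz]; exact h.commutator_pow_left hp hΓ hH hK hw hy hwi hyi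
    · rw [← hwz]; exact h.commutator_pow_left hp hΓ hH hK hw hx hwi hxi

/-- Conjugation by x sends c⁻¹ = (c⁻¹a)a⁻¹ to (c⁻¹a)a = c⁻¹a² = c. -/
theorem inverted_of_commute {Q : Type*} [Group Q] {x a c : Q} (ha : x * a * x⁻¹ * a = 1)
    (hsq : c ^ 2 = a ^ 2) (hca : ⁅c, a⁆ = 1) (hx : ⁅c⁻¹ * a, x⁆ = 1) : x * c * x⁻¹ * c = 1 := by
  have hca : Commute c a := commutatorElement_eq_one_iff_commute.1 hca
  have hx : Commute (c⁻¹ * a) x := commutatorElement_eq_one_iff_commute.1 hx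
  have hxa : x * a * x⁻¹ = a⁻¹ := eq_inv_of_mul_eq_one_left ha
  have e1 : x * (c⁻¹ * a) * x⁻¹ = c⁻¹ * a := by rw [← hx.eq]; group
  have e2 : x * c⁻¹ * x⁻¹ = c⁻¹ * a * a := by
    calc x * c⁻¹ * x⁻¹ = (x * (c⁻¹ * a) * x⁻¹) * (x * a * x⁻¹)⁻¹ := by group
      _ = _ := by rw [e1, hxa, inv_inv]
  have e3 : x * c⁻¹ * x⁻¹ = c := by
    rw [e2, mul_assoc, ← pow_two, ← hsq, pow_two]; group
  have e4 : x * c * x⁻¹ = c⁻¹ := by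
    calc x * c * x⁻¹ = (x * c⁻¹ * x⁻¹)⁻¹ := by group
      _ = c⁻¹ := by rw [e3]
  rw [e4, inv_mul_cancel]

end Bounds

/-! ### The product bound for p = 2. -/

section Two

variable {Γ : Type u} [Group Γ] {p : ℕ} {N M K : Subgroup Γ}

theorem inverted_mem {x a c : Γ} (hN : NormalizedBy N K) (hx : x ∈ K) (ha : a ∈ K) (hc : c ∈ K)
    (hxa : x * a * x⁻¹ * a ∈ N) (hsq : (c ^ 2)⁻¹ * a ^ 2 ∈ N) (hca : ⁅c, a⁆ ∈ N)
    (hcx : ⁅c⁻¹ * a, x⁆ ∈ N) : x * c * x⁻¹ * c ∈ N := by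
  obtain ⟨Q, _, φ, hφ⟩ := exists_hom_of_normalizedBy hN
  set x' : K := ⟨x, hx⟩
  set a' : K := ⟨a, ha⟩
  set c' : K := ⟨c, hc⟩
  refine (hφ (x' * c' * x'⁻¹ * c')).1 ?_
  have h1 := (hφ (x' * a' * x'⁻¹ * a')).2 hxa
  have h2 := (hφ ((c' ^ 2)⁻¹ * a' ^ 2)).2 hsq
  have h3 := (hφ ⁅c', a'⁆).2 hca
  have h4 := (hφ ⁅c'⁻¹ * a', x'⁆).2 hcx
  simp only [map_mul, map_inv, map_commutatorElement, map_pow] at h1 h2 h3 h4 ⊢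
  exact inverted_of_commute h1 (inv_mul_eq_one.1 h2) h3 h4

theorem inverted_pow_mem {x a : Γ} (hN : NormalizedBy N K) (hx : x ∈ K) (ha : a ∈ K)
    (hxa : x * a * x⁻¹ * a ∈ N) (n : ℕ) : x * a ^ n * x⁻¹ * a ^ n ∈ N := by
  obtain ⟨Q, _, φ, hφ⟩ := exists_hom_of_normalizedBy hN
  set x' : K := ⟨x, hx⟩
  set a' : K := ⟨a, ha⟩
  refine (hφ (x' * a' ^ n * x'⁻¹ * a' ^ n)).1 ?_
  have h1 := (hφ (x' * a' * x'⁻¹ * a')).2 hxa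
  simp only [map_mul, map_inv, map_pow] at h1 ⊢
  rw [← conj_pow, eq_inv_of_mul_eq_one_left h1, inv_pow, inv_mul_cancel]

/-- Modulo the torsion, ⁅x, a⁆⁻¹ is a². It also has a square root c deeper in the filtration, and c
inherits the hypotheses on a, so one can push down until the filtration vanishes. -/
theorem sq_mem_of_inverted {i : ℕ} [Finite Γ] (hΓ : IsPGroup 2 Γ)
    (h : PowerfullyEmbedded 2 K K) (hH : HasOmegaBounds 2 (powClosure 2 K))
    (hK : ∀ ⦃i : ℕ⦄ ⦃x y : Γ⦄, x ∈ K → y ∈ K → y ^ 2 ^ i = 1 → ⁅x, y⁆ ^ 2 ^ i = 1)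
    (hHM : powClosure 2 K ≤ M)
    (hM : ∀ x ∈ M, ∀ y ∈ M, x ^ 2 ^ i = 1 → y ^ 2 ^ i = 1 → (x * y) ^ 2 ^ i = 1)
    (hN : NormalizedBy (torsionIn M (2 ^ i) hM) K) {x : Γ} (hx : x ∈ K)
    (hxi : x ^ 2 ^ (i + 1) = 1) {a : Γ} (ha : a ∈ powClosure 2 K)
    (hxa : x * a * x⁻¹ * a ∈ torsionIn M (2 ^ i) hM)
    (ha4 : a ^ 4 ∈ torsionIn M (2 ^ i) hM) : a ^ 2 ∈ torsionIn M (2 ^ i) hM := by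
  have hp := Nat.prime_two
  have : Fact (Nat.Prime 2) := ⟨hp⟩
  have : Group.IsNilpotent Γ := hΓ.isNilpotent
  obtain ⟨e, he⟩ := exists_forall_pow_eq_one hΓ
  have hpe := (h.powClosure hp).self
  have hHK : powClosure 2 K ≤ K := powClosure_le
  suffices H : ∀ d m, e ≤ m + d → ∀ a ∈ iterPow 2 K (m + 1),
      x * a * x⁻¹ * a ∈ torsionIn M (2 ^ i) hM → a ^ 4 ∈ torsionIn M (2 ^ i) hM →
      a ^ 2 ∈ torsionIn M (2 ^ i) hM from H e 0 (by omega) a ha hxa ha4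
  clear ha hxa ha4 a
  intro d
  induction d with
  | zero =>
    intro m hm a ha _ _
    obtain ⟨w, -, rfl⟩ := h.exists_pow_pow_eq hp hΓ ha
    rw [he w _ (by omega), one_pow]; exact one_mem _
  | succ d ih =>
    intro m hm a ha hxa ha4
    have haH : a ∈ powClosure 2 K := iterPow_antitone (Nat.le_add_left 1 m) ha
    have haK := hHK haH
    have hcomm : ⁅x, a⁆⁻¹ ∈ powClosure 2 (iterPow 2 K (m + 2)) := by
      rw [← iterPow_succ]
      exact inv_mem (mem_of_mem_commutator_le' (h.commutator_iterPow_two_le (m + 1)) ha hx)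
    obtain ⟨c, hc, hca⟩ := (h.iterPow hp (m + 2)).self.exists_pow_eq hp hΓ hcomm
    have hcH2 : c ∈ iterPow 2 K 2 := iterPow_antitone (Nat.le_add_left 2 m) hc
    have hcH : c ∈ powClosure 2 K := iterPow_succ_le 1 hcH2
    have hcK := hHK hcH
    have hsq : (c ^ 2)⁻¹ * a ^ 2 ∈ torsionIn M (2 ^ i) hM := by
      have e : (c ^ 2)⁻¹ * a ^ 2 = x * a * x⁻¹ * a := by
        rw [hca, inv_inv, commutatorElement_def, pow_two]; group
      rwa [e]
    have hsq' : c ^ 2 * (a ^ 2)⁻¹ ∈ torsionIn M (2 ^ i) hM := by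
      have := hN _ (pow_mem hcK 2) _ (inv_mem hsq)
      rwa [show c ^ 2 * ((c ^ 2)⁻¹ * a ^ 2)⁻¹ * (c ^ 2)⁻¹ = c ^ 2 * (a ^ 2)⁻¹ by group] at this
    have hc4 : c ^ 4 ∈ torsionIn M (2 ^ i) hM := by
      have e : c ^ 4 = (c ^ 2 * (c ^ 2 * (a ^ 2)⁻¹) * (c ^ 2)⁻¹) *
          (c ^ 2 * (a ^ 2)⁻¹) * a ^ 4 := by
        rw [show (4 : ℕ) = 2 + 2 from rfl, pow_add c, pow_add a]; group
      rw [e]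
      exact mul_mem (mul_mem (hN _ (pow_mem hcK 2) _ hsq') hsq') ha4
    have ha4' : a ^ 2 ^ (i + 2) = 1 := by
      have := ha4.2
      rwa [← pow_mul, show 4 * 2 ^ i = 2 ^ (i + 2) by ring] at this
    have hc4' : c ^ 2 ^ (i + 2) = 1 := by
      have := hc4.2
      rwa [← pow_mul, show 4 * 2 ^ i = 2 ^ (i + 2) by ring] at this
    have hcam : ⁅c, a⁆ ∈ torsionIn M (2 ^ i) hM := by
      refine ⟨hHM (NormalizedBy.self.commutator_mem_left hcH haH), ?_⟩
      obtain ⟨v, hv, rfl⟩ := h.exists_pow_pow_eq hp hΓ hcH2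
      obtain ⟨w, hw, rfl⟩ := h.exists_pow_pow_eq hp hΓ (n := 1) haH
      rw [pow_pow_pow_eq] at hc4' ha4'
      refine h.commutator_pow_pow hp hΓ hH hK 2 1 hv hw ?_ ?_
      · rw [← hc4']; congr 2; omega
      · rw [← ha4']; congr 2; omega
    have heH : c⁻¹ * a ∈ powClosure 2 K := mul_mem (inv_mem hcH) haH
    have he2 : (c⁻¹ * a) ^ 2 ∈ torsionIn M (2 ^ i) hM := by
      have hz : ⁅a, c⁻¹⁆ ∈ torsionIn M (2 ^ i) hM := by
        have := hN _ (inv_mem hcK) _ hcam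
        rwa [show c⁻¹ * ⁅c, a⁆ * c⁻¹⁻¹ = ⁅a, c⁻¹⁆ by
          simp only [commutatorElement_def]; group] at this
      have := mul_mem (mul_pow_mul_inv_mem hp hN (inv_mem hcK) haK (pow_mem hz 2)
        (hN.commutator_mem_left hz haK) (hN.commutator_mem_left hz (inv_mem hcK)) fun _ => hz) hsq
      rwa [inv_pow, inv_inv, mul_assoc, mul_inv_cancel_left, inv_mul_cancel_right] at this
    have hcx : ⁅c⁻¹ * a, x⁆ ∈ torsionIn M (2 ^ i) hM := by
      refine ⟨hHM ((h.powClosure hp).normalizedBy.commutator_mem_left heH hx), ?_⟩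
      -- Since c⁻¹a = f² has its square in the torsion, f has order dividing 2^(i+2), and ⁅f², x⁆ is
      -- bounded.
      obtain ⟨f, hf, hfe⟩ := h.exists_pow_eq hp hΓ heH
      have := he2.2
      rw [← hfe, pow_pow_pow_one_eq, pow_pow_pow_one_eq] at this
      rw [← hfe]
      exact h.commutator_pow_left hp hΓ hH hK hf hx this hxi
    have hc2 := ih (m + 1) (by omega) c hc (inverted_mem hN hx haK hcK hxa hsq hcam hcx) hc4
    have := mul_mem hc2 hsq
    rwa [mul_inv_cancel_left] at this

theorem eq_one_or_mul_eq_one_of_mem_zpowers {Q : Type*} [Group Q] {t a b : Q} (ht : t * t = 1)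
    (ha : a ∈ Subgroup.zpowers t) (hb : b ∈ Subgroup.zpowers t) : a = 1 ∨ b = 1 ∨ a * b = 1 := by
  have key : ∀ c ∈ Subgroup.zpowers t, c = 1 ∨ c = t := by
    intro c hc
    obtain ⟨k, rfl⟩ := Subgroup.mem_zpowers_iff.1 hc
    rcases Int.even_or_odd' k with ⟨n, rfl | rfl⟩
    · left; rw [zpow_mul, zpow_two, ht, one_zpow]
    · right; rw [zpow_add, zpow_mul, zpow_two, ht, one_zpow, one_mul, zpow_one]
  rcases key a ha with h | h
  · exact Or.inl h
  rcases key b hb with h' | h'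
  · exact Or.inr (Or.inl h')
  · exact Or.inr (Or.inr (by rw [h, h', ht]))

theorem PowerfullyEmbedded.mul_of_two [Finite Γ] (hΓ : IsPGroup 2 Γ)
    (h : PowerfullyEmbedded 2 K K) (hH : HasOmegaBounds 2 (_root_.powClosure 2 K))
    (hK : ∀ ⦃i : ℕ⦄ ⦃x y : Γ⦄, x ∈ K → y ∈ K → y ^ 2 ^ i = 1 → ⁅x, y⁆ ^ 2 ^ i = 1)
    {i : ℕ} {x y : Γ} (hx : x ∈ K) (hy : y ∈ K) (hxi : x ^ 2 ^ i = 1) (hyi : y ^ 2 ^ i = 1)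
    (hxy : x ∈ _root_.powClosure 2 K ∨ y ∈ _root_.powClosure 2 K ∨
      x * y ∈ _root_.powClosure 2 K) : (x * y) ^ 2 ^ i = 1 := by
  have hp := Nat.prime_two
  have : Fact (Nat.Prime 2) := ⟨hp⟩
  have : Group.IsNilpotent Γ := hΓ.isNilpotent
  induction i generalizing x y with
  | zero => simp_all
  | succ i ih =>
    have hHK : _root_.powClosure 2 K ≤ K := powClosure_le
    have hHn := (h.powClosure hp).normalizedBy
    obtain ⟨t, ht, hxt, hyt⟩ : ∃ t ∈ K, x ∈ Subgroup.zpowers t ⊔ _root_.powClosure 2 K ∧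
        y ∈ Subgroup.zpowers t ⊔ _root_.powClosure 2 K := by
      rcases hxy with hxy | hxy | hxy
      · exact ⟨y, hy, Subgroup.mem_sup_right hxy, Subgroup.mem_sup_left (Subgroup.mem_zpowers y)⟩
      · exact ⟨x, hx, Subgroup.mem_sup_left (Subgroup.mem_zpowers x), Subgroup.mem_sup_right hxy⟩
      · refine ⟨x, hx, Subgroup.mem_sup_left (Subgroup.mem_zpowers x), ?_⟩
        have := mul_mem (inv_mem (Subgroup.mem_sup_left (Subgroup.mem_zpowers x)))
          (Subgroup.mem_sup_right (S := Subgroup.zpowers x) hxy)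
        rwa [inv_mul_cancel_left] at this
    set M := Subgroup.zpowers t ⊔ _root_.powClosure 2 K with hMdef
    have hHM : _root_.powClosure 2 K ≤ M := le_sup_right
    have hMK : M ≤ K := sup_le (by simpa using ht) hHK
    have hMn : NormalizedBy M K := NormalizedBy.of_commutator_mem fun g hg n hn =>
      hHM (mem_of_mem_commutator_le h.commutator_le' hg (hMK hn))
    -- M/K² has order at most 2, so the side condition of the induction hypothesis holds throughout
    -- M.
    have hprod : ∀ a ∈ M, ∀ b ∈ M, a ∈ _root_.powClosure 2 K ∨ b ∈ _root_.powClosure 2 K ∨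
        a * b ∈ _root_.powClosure 2 K := by
      obtain ⟨Q, _, φ, hφ⟩ := exists_hom_of_normalizedBy hHn
      set t' : K := ⟨t, ht⟩
      have ht2 : φ t' * φ t' = 1 := by
        rw [← pow_two, ← map_pow]; exact (hφ _).2 (pow_mem_powClosure ht)
      have hle : M ≤ ((Subgroup.zpowers (φ t')).comap φ).map K.subtype := by
        refine sup_le ?_ fun m hm => ⟨⟨m, hHK hm⟩, ?_, rfl⟩
        · rw [Subgroup.zpowers_le]
          exact ⟨t', Subgroup.mem_zpowers _, rfl⟩
        · exact (congrArg (· ∈ Subgroup.zpowers (φ t'))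
            ((hφ ⟨m, hHK hm⟩).2 hm)).mpr (one_mem _)
      rintro a ha b hb
      obtain ⟨a, haφ, rfl⟩ := hle ha
      obtain ⟨b, hbφ, rfl⟩ := hle hb
      have := eq_one_or_mul_eq_one_of_mem_zpowers ht2 haφ hbφ
      rwa [← map_mul, hφ, hφ, hφ] at this
    have hM : ∀ x ∈ M, ∀ y ∈ M, x ^ 2 ^ i = 1 → y ^ 2 ^ i = 1 → (x * y) ^ 2 ^ i = 1 :=
      fun a ha b hb hai hbi => ih (hMK ha) (hMK hb) hai hbi (hprod a ha b hb)
    have hN := hMn.torsionIn (h := hM)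
    have hxN : x ^ 2 ∈ torsionIn M (2 ^ i) hM :=
      ⟨pow_mem hxt 2, by rw [pow_pow_pow_one_eq, hxi]⟩
    have hyN : y ^ 2 ∈ torsionIn M (2 ^ i) hM :=
      ⟨pow_mem hyt 2, by rw [pow_pow_pow_one_eq, hyi]⟩
    suffices hmem : (x * y) ^ 2 ∈ torsionIn M (2 ^ i) hM by
      have := hmem.2; rwa [pow_pow_pow_one_eq] at this
    have hcommute : ⁅y, x⁆ ^ 2 ^ i = 1 → (x * y) ^ 2 ∈ torsionIn M (2 ^ i) hM := fun hc => by
      have hz : ⁅y, x⁆ ∈ torsionIn M (2 ^ i) hM := ⟨hMn.commutator_mem_left hyt hx, hc⟩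
      exact mul_pow_mem hp hN hx hy hxN hyN (pow_mem hz 2) (hN.commutator_mem_left hz hy)
        (hN.commutator_mem_left hz hx) fun _ => hz
    rcases hxy with hxH | hyH | hxyH
    · obtain ⟨w, hw, hwx⟩ := h.exists_pow_eq hp hΓ hxH
      rw [← hwx, pow_pow_pow_one_eq] at hxi
      refine hcommute (commutator_swap_pow_eq_one ?_)
      rw [← hwx]
      exact h.commutator_pow_left hp hΓ hH hK hw hy hxi hyi
    · obtain ⟨w, hw, hwy⟩ := h.exists_pow_eq hp hΓ hyH
      rw [← hwy, pow_pow_pow_one_eq] at hyi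
      refine hcommute ?_
      rw [← hwy]
      exact h.commutator_pow_left hp hΓ hH hK hw hx hyi hxi
    · have hinv : x * (x * y) * x⁻¹ * (x * y) ∈ torsionIn M (2 ^ i) hM := by
        have := mul_mem hxN hyN
        rwa [show x ^ 2 * y ^ 2 = x * (x * y) * x⁻¹ * (x * y) by
          rw [pow_two, pow_two]; group] at this
      obtain ⟨e, he⟩ := exists_forall_pow_eq_one hΓ
      -- The fourth power of (xy)^(2^s) is the square of (xy)^(2^(s+1)), so descending induction on
      -- s supplies `ha4`.
      suffices H : ∀ d s, e ≤ s + d →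
          ((x * y) ^ 2 ^ s) ^ 2 ∈ torsionIn M (2 ^ i) hM by simpa using H e 0 (by omega)
      intro d
      induction d with
      | zero => intro s hs; rw [he _ s hs, one_pow]; exact one_mem _
      | succ d ihd =>
        intro s hs
        refine sq_mem_of_inverted hΓ h hH hK hHM hM hN hx hxi (pow_mem hxyH _)
          (inverted_pow_mem hN hx (mul_mem hx hy) hinv _) ?_
        have := ihd (s + 1) (by omega)
        rwa [← pow_mul, show 2 ^ (s + 1) * 2 = 2 ^ s * 4 by ring, pow_mul] at this

end Two

/-! ### The induction on the order of K. -/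

section Main

variable {Γ : Type u} [Group Γ] {p : ℕ} {K : Subgroup Γ}

theorem PowerfullyEmbedded.hasOmegaBounds [Finite Γ] (hp : p.Prime) (hΓ : IsPGroup p Γ)
    (h : PowerfullyEmbedded p K K) : HasOmegaBounds p K := by
  have : Fact p.Prime := ⟨hp⟩
  have : Group.IsNilpotent Γ := hΓ.isNilpotent
  induction hn : Nat.card K using Nat.strong_induction_on generalizing K with
  | _ n ih =>
    have ih' : ∀ T : Subgroup Γ, PowerfullyEmbedded p T T → T ≤ K → T ≠ K →
        HasOmegaBounds p T := fun T hT hTK hne => ih _ (by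
      rw [← hn]
      exact lt_of_le_of_ne (Subgroup.card_le_of_le hTK) fun e =>
        hne (Subgroup.eq_of_le_of_card_ge hTK e.ge)) hT rfl
    have hpe := h.powClosure hp
    have hHK : _root_.powClosure p K ≤ K := powClosure_le
    rcases eq_or_ne K ⊥ with rfl | hbot
    · constructor
      · rintro i x y hx hy -
        rw [Subgroup.mem_bot.1 hx]; simp
      · rintro r j k x y hx hy - -
        rw [Subgroup.mem_bot.1 hx]; simp
      · rintro i x y hx hy hx' hy' -
        rw [Subgroup.mem_bot.1 hx, one_mul]; exact hy'
    have hH : HasOmegaBounds p (_root_.powClosure p K) := ih' _ hpe.self hHK fun e => hbot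
      (eq_of_sup_powClosure hp hΓ bot_le (by rw [bot_sup_eq, e])).symm
    have hK : ∀ ⦃i : ℕ⦄ ⦃x y : Γ⦄, x ∈ K → y ∈ K → y ^ p ^ i = 1 → ⁅x, y⁆ ^ p ^ i = 1 := by
      intro i x y hx hy hyi
      have hyK : Subgroup.zpowers y ≤ K := by simpa using hy
      have hTK : Subgroup.zpowers y ⊔ _root_.powClosure p K ≤ K := sup_le hyK hHK
      rcases eq_or_ne (Subgroup.zpowers y ⊔ _root_.powClosure p K) K with e | e
      · have hKy : Subgroup.zpowers y = K := eq_of_sup_powClosure hp hΓ hyK e.ge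
        rw [← hKy] at hx
        obtain ⟨k, rfl⟩ := Subgroup.mem_zpowers_iff.1 hx
        rw [commutatorElement_eq_one_iff_commute.2 ((Commute.refl y).zpow_left k), one_pow]
      · have hT := ih' _ (h.zpowers_sup hp hy) hTK e
        have hyT : y ∈ Subgroup.zpowers y ⊔ _root_.powClosure p K :=
          Subgroup.mem_sup_left (Subgroup.mem_zpowers y)
        have hc : ⁅x, y⁆ ∈ _root_.powClosure p K := mem_of_mem_commutator_le h.commutator_le' hx hy
        have hxy : x * y * x⁻¹ ∈ Subgroup.zpowers y ⊔ _root_.powClosure p K := by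
          rw [show x * y * x⁻¹ = ⁅x, y⁆ * y by rw [commutatorElement_def]; group]
          exact mul_mem (Subgroup.mem_sup_right hc) hyT
        rw [commutatorElement_def]
        -- Although x need not lie in T, the conjugate of y by x does, because ⁅x, y⁆ ∈ K^p.
        refine hT.mul hxy (inv_mem hyT) (by rw [conj_pow, hyi]; simp)
          (by rw [inv_pow, hyi, inv_one]) ?_
        rintro rfl
        refine Or.inr (Or.inr ?_)
        rw [← commutatorElement_def]
        exact powClosure_mono le_sup_right
          (mem_of_mem_commutator_le (h.commutator_iterPow_two_le 0) hx hy)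
    refine ⟨hK, fun r j k x y hx hy hxr hyr =>
      h.commutator_pow_pow hp hΓ hH hK j k hx hy hxr hyr, fun i x y hx hy hxi hyi hxy => ?_⟩
    rcases eq_or_ne p 2 with rfl | h2
    · exact h.mul_of_two hΓ hH hK hx hy hxi hyi (hxy rfl)
    · exact h.mul_of_odd hp hΓ h2 hH hK hx hy hxi hyi

end Main

/-! ### From subgroups and vanishing powers to orders, exponents and cyclic-over subgroups. -/

section Translation

variable {G : Type u} [Group G] {p : ℕ}

theorem powClosure_top (n : ℕ) : powClosure n (⊤ : Subgroup G) = powSubgroup n G := by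
  unfold powClosure powSubgroup
  congr 1
  ext g
  simp

theorem IsPowerful.powerfullyEmbedded (h : IsPowerful p G) :
    PowerfullyEmbedded p (⊤ : Subgroup G) ⊤ where
  le := le_rfl
  normalizedBy := .self
  commutator_le := by rw [powClosure_top]; exact h

theorem IsPGroup.orderOf_le_iff (hp : p.Prime) (hG : IsPGroup p G) (x : G) (i : ℕ) :
    orderOf x ≤ p ^ i ↔ x ^ p ^ i = 1 := by
  have : Fact p.Prime := ⟨hp⟩
  obtain ⟨k, hk⟩ := IsPGroup.iff_orderOf.1 hG x
  rw [← orderOf_dvd_iff_pow_eq_one, hk, Nat.pow_le_pow_iff_right hp.one_lt,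
    Nat.pow_dvd_pow_iff_le_right hp.one_lt]

theorem IsPGroup.orderLE_natCast_iff (hp : p.Prime) (hG : IsPGroup p G) (x : G) (i : ℕ) :
    OrderLE p x (i : ℤ) ↔ x ^ p ^ i = 1 := by
  rw [OrderLE, if_pos (Int.natCast_nonneg i), Int.toNat_natCast, hG.orderOf_le_iff hp]

theorem groupComm_eq (x y : G) : groupComm x y = ⁅x⁻¹, y⁻¹⁆ := by
  rw [groupComm, commutatorElement_def, inv_inv, inv_inv]

theorem exponent_omegaSubgroup_le (hp : p.Prime) (hG : IsPGroup p G) (i : ℕ)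
    (h : ∀ x y : G, x ^ p ^ i = 1 → y ^ p ^ i = 1 → (x * y) ^ p ^ i = 1) :
    Monoid.exponent (omegaSubgroup p i G) ≤ p ^ i := by
  refine Nat.le_of_dvd (pow_pos hp.pos i) (Monoid.exponent_dvd_of_forall_pow_eq_one fun g => ?_)
  obtain ⟨g, hg⟩ := g
  refine Subtype.ext ?_
  rw [Subgroup.coe_pow, Subgroup.coe_one]
  unfold omegaSubgroup at hg
  induction hg using Subgroup.closure_induction with
  | mem x hx => exact (hG.orderOf_le_iff hp x i).1 hx
  | one => exact one_pow _
  | mul x y _ _ hx hy => exact h x y hx hy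
  | inv x _ hx => rw [inv_pow, hx, inv_one]

/-- The image of T in G/G² is cyclic of exponent dividing 2, so it has at most two elements. -/
theorem IsCyclicOver.mul_mem {T : Subgroup G} (hT : IsCyclicOver T (powSubgroup 2 G)) {a b : G}
    (ha : a ∈ T) (hb : b ∈ T) :
    a ∈ powSubgroup 2 G ∨ b ∈ powSubgroup 2 G ∨ a * b ∈ powSubgroup 2 G := by
  obtain ⟨t, ht⟩ := hT.exists_generator
  have hmem : ∀ c ∈ T, (c : G ⧸ powSubgroup 2 G) ∈ Subgroup.zpowers t.1 := by
    intro c hc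
    obtain ⟨k, hk⟩ := Subgroup.mem_zpowers_iff.1 (ht ⟨_, Subgroup.mem_map_of_mem _ hc⟩)
    exact Subgroup.mem_zpowers_iff.2 ⟨k, congrArg Subtype.val hk⟩
  have ht2 : t.1 * t.1 = 1 := by
    obtain ⟨s, -, hs⟩ := t.2
    rw [← hs, ← map_mul, ← pow_two]
    exact (QuotientGroup.eq_one_iff _).2 (Subgroup.subset_closure ⟨s, rfl⟩)
  have := eq_one_or_mul_eq_one_of_mem_zpowers ht2 (hmem a ha) (hmem b hb)
  rwa [← QuotientGroup.mk_mul, QuotientGroup.eq_one_iff, QuotientGroup.eq_one_iff,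
    QuotientGroup.eq_one_iff] at this

theorem isCyclicOver_self (N : Subgroup G) [N.Normal] : IsCyclicOver N N := by
  have : N.map (QuotientGroup.mk' N) = ⊥ := by
    rw [Subgroup.map_eq_bot_iff, QuotientGroup.ker_mk']
  unfold IsCyclicOver
  rw [this]
  infer_instance

theorem HasOmegaBounds.exponent_le_of_isCyclicOver (h : HasOmegaBounds 2 (⊤ : Subgroup G))
    (hG : IsPGroup 2 G) (i : ℕ) {T : Subgroup G} (hT : IsCyclicOver T (powSubgroup 2 G)) :
    Monoid.exponent (omegaSubgroup 2 i T) ≤ 2 ^ i := by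
  refine exponent_omegaSubgroup_le Nat.prime_two (hG.to_subgroup T) i fun x y hx hy => ?_
  refine Subtype.ext ?_
  have := h.mul (Subgroup.mem_top (x : G)) (Subgroup.mem_top (y : G)) (i := i)
    (by exact_mod_cast congrArg Subtype.val hx) (by exact_mod_cast congrArg Subtype.val hy)
    fun _ => by rw [powClosure_top]; exact hT.mul_mem x.2 y.2
  exact_mod_cast this

theorem HasOmegaBounds.orderLE_groupComm_pow (hp : p.Prime) (hG : IsPGroup p G)
    (h : HasOmegaBounds p (⊤ : Subgroup G)) {i : ℕ} {x y : G} (hx : x ^ p ^ (i + 1) = 1)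
    (hy : y ^ p ^ i = 1) (j k : ℕ) :
    OrderLE p (groupComm (x ^ p ^ j) (y ^ p ^ k)) ((i : ℤ) - j - k) := by
  have key : ∀ r j k, r + j + k = i → ⁅x⁻¹ ^ p ^ j, y⁻¹ ^ p ^ k⁆ ^ p ^ r = 1 := by
    rintro r j k rfl
    exact h.commutator_pow j k (Subgroup.mem_top _) (Subgroup.mem_top _)
      (by rw [inv_pow, hx, inv_one]) (by rw [inv_pow, hy, inv_one])
  rw [groupComm_eq, ← inv_pow, ← inv_pow]
  by_cases hle : j + k ≤ i
  · obtain ⟨r, rfl⟩ := Nat.exists_eq_add_of_le' hle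
    rw [show ((r + (j + k) : ℕ) : ℤ) - j - k = (r : ℤ) by push_cast; ring,
      hG.orderLE_natCast_iff hp]
    exact key r j k (by omega)
  · rw [OrderLE, if_neg (by omega)]
    -- When i < j + k, split i as min j i + (i - min j i): the bound with r = 0 gives commuting
    -- powers, and further powers still commute.
    have hc : Commute (x⁻¹ ^ p ^ min j i) (y⁻¹ ^ p ^ (i - min j i)) := by
      have := key 0 (min j i) (i - min j i) (by omega)
      rwa [pow_zero, pow_one, commutatorElement_eq_one_iff_commute] at this
    rw [commutatorElement_eq_one_iff_commute]
    have := (hc.pow_left (p ^ (j - min j i))).pow_right (p ^ (k - (i - min j i)))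
    rwa [pow_pow_pow_eq, pow_pow_pow_eq, show min j i + (j - min j i) = j by omega,
      show i - min j i + (k - (i - min j i)) = k by omega] at this

end Translation

theorem theorem1 {p : ℕ} (hp : p.Prime) {G : Type*} [Group G] [Finite G]
    (hG : IsPGroup p G) (hpow : IsPowerful p G) (i : ℕ) :
    (∀ x y : G, OrderLE p y i → OrderLE p (groupComm x y) i) ∧
    (∀ x y : G, OrderLE p x ((i : ℤ) + 1) → OrderLE p y i →
      ∀ j k : ℕ, OrderLE p (groupComm (x ^ p ^ j) (y ^ p ^ k)) ((i : ℤ) - j - k)) ∧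
    (Odd p → Monoid.exponent (omegaSubgroup p i G) ≤ p ^ i) ∧
    (p = 2 →
      (∀ T : Subgroup G, IsCyclicOver T (powSubgroup 2 G) →
        Monoid.exponent (omegaSubgroup 2 i T) ≤ 2 ^ i) ∧
      Monoid.exponent (omegaSubgroup 2 i (powSubgroup 2 G)) ≤ 2 ^ i) := by
  have h := hpow.powerfullyEmbedded.hasOmegaBounds hp hG
  refine ⟨fun x y hy => ?_, fun x y hx hy j k => ?_, fun hodd => ?_, ?_⟩
  · rw [hG.orderLE_natCast_iff hp] at hy ⊢
    rw [groupComm_eq]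
    exact h.commutator (Subgroup.mem_top _) (Subgroup.mem_top _) (by rw [inv_pow, hy, inv_one])
  · rw [← Nat.cast_succ, hG.orderLE_natCast_iff hp] at hx
    rw [hG.orderLE_natCast_iff hp] at hy
    exact h.orderLE_groupComm_pow hp hG hx hy j k
  · refine exponent_omegaSubgroup_le hp hG i fun x y hx hy =>
      h.mul (Subgroup.mem_top _) (Subgroup.mem_top _) hx hy ?_
    rintro rfl
    exact absurd hodd (by decide)
  · rintro rfl
    exact ⟨fun T hT => h.exponent_le_of_isCyclicOver hG i hT,
      h.exponent_le_of_isCyclicOver hG i (isCyclicOver_self _)⟩
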